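/- **Conventions.** A symmetric set-operad is a family of sets $P(I)$, for all nonempty finite sets $I$, functorial in bijections (relabelling), with a unit in $P(\{*\})$ and partial compositions $\circ_x : P(I)\times P(J)\to P((I\setminus\{x\})\sqcup J)$ for $x\in I$, natural in bijections and satisfying the unit axioms, $(A\circ_x B)\circ_y C=A\circ_x(B\circ_y C)$ for $y$ a label of $B$, and $(A\circ_x B)\circ_y C=(A\circ_y C)\circ_x B$ for $x\ne y$ labels of $A$. Taking $I=\{1,\dots,n\}$ gives the usual description by sets $P(n)$ with actions of the symmetric groups. **Fractions.** Let $\mathrm{MFF}(I)$ be the set of pairs $(m,F)$, written $mF$, where $m$ is a monomial in variables $(u_a)_{a\in I}$, and $F$ is a simplified fraction whose numerator and denominator are products of formal symbols $[S]$, $\emptyset\neq S\subseteq I$. It is a symmetric operad for $$(m,F)\circ_x(m',F')=\Big(m|_{u_x:=\prod_{b\in J}u_b}\; m',\ [J]\,F|_{x:=J}\,F'\Big),$$ where $F|_{x:=J}$ is obtained by replacing $x$ by the elements of $J$ in every symbol containing $x$; the unit is $(1,1/[*])$. Let $\mathrm{FF}_6^\Sigma$ be the symmetric sub-operad of $\mathrm{MFF}$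 generated by the six elements of $\mathrm{MFF}(\{1,2\})$ $$\frac1{[1][12]},\quad \frac1{[2][12]},\quad \frac1{[12]},\quad \frac1{[1][2]},\quad \frac{u_1}{[1][12]},\quad \frac{u_2}{[2][12]}.$$ **Trees.** A dotted red and white tree labelled by $I$ is a finite rooted tree (children unordered, up to isomorphism of labelled trees) in which each label of $I$ is placed in exactly one node, each node carrying a possibly empty set of labels and each node without labels having at least two children. A node is red if it has no labels and all its children are white, and white otherwise. Each edge between two white nodes may or may not be dotted; other edges are not dotted. For $x$ a label of $T_1$, in the node $z$, the tree $T_1\circ_x T_2$ is defined as follows. * (W) If the root of $T_2$ is white: erase $x$ from $z$, add to $z$ the labels of the root of $T_2$, and make the children of this root children of $z$, keeping the dots. * If the root of $T_2$ is red: * (R1) if $T_1$ has a single node, with the single label $x$, the result is $T_2$; * (R2) if $z$ is not a leaf, or has several labels, erase $x$ from $z$ and glue the root of $T_2$ as a child of $z$ by an undotted edge; * (R3) otherwise $z$ is a leaf with only label $x$ and with a parent $z'$: remove $z$ and make the children of the root of $T_2$ children of $z'$; the new edges are dotted if the edge from $z'$ to $z$ was dotted, and undotted otherwise. Nodes coming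 from $T_1$ and $T_2$ keep their colour (so $z$ stays white even when it loses its last label). The unit is the tree with one node and one label. **Theorem.** With these compositions, $\mathrm{FF}_6^\Sigma$ and the (arbitrarily labelled) dotted red and white trees are symmetric set-operads, and they are isomorphic as symmetric set-operads. -/

import Mathlib

/-! ### Symmetric set-operads, in the language of species -/

/-- The label set `(I ∖ {x}) ⊔ J` of a composition `A ∘ₓ B`, where `A` is labelled by `I`
and `B` is labelled by `J`. -/
abbrev Ins {I : Type} (x : I) (J : Type) : Type := {a : I // a ≠ x} ⊕ J

namespace Ins

/-- The bijection of label sets induced by bijections of the two pieces. -/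
def congr {I I' J J' : Type} (f : I ≃ I') (g : J ≃ J') (x : I) : Ins x J ≃ Ins (f x) J' :=
  Equiv.sumCongr (f.subtypeEquiv fun a => by simp) g

/-- `({∗} ∖ {∗}) ⊔ J = J`. -/
def unitLeft (J : Type) : Ins () J ≃ J :=
  haveI : IsEmpty {a : Unit // a ≠ ()} := ⟨fun a => a.2 rfl⟩
  Equiv.emptySum _ _

open Classical in
/-- `(I ∖ {x}) ⊔ {∗} ≃ I`, sending `∗` to `x`. -/
noncomputable def unitRight {I : Type} (x : I) : Ins x Unit ≃ I where
  toFun := Sum.elim (fun a => a.1) (fun _ => x)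
  invFun a := if h : a = x then Sum.inr () else Sum.inl ⟨a, h⟩
  left_inv := by
    rintro (⟨a, ha⟩ | ⟨⟩) <;> simp [*]
  right_inv a := by
    by_cases h : a = x <;> simp [h]

/-- The identification of the label sets of `(A ∘ₓ B) ∘_y C` and `A ∘ₓ (B ∘_y C)`,
for `y` a label of `B`. -/
def seq {I J : Type} (x : I) (y : J) (K : Type) :
    Ins (Sum.inr y : Ins x J) K ≃ Ins x (Ins y K) where
  toFun t := match t with
    | Sum.inl ⟨Sum.inl a, _⟩ => Sum.inl a
    | Sum.inl ⟨Sum.inr b, h⟩ => Sum.inr (Sum.inl ⟨b, fun e => h (congrArg Sum.inr e)⟩)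
    | Sum.inr c => Sum.inr (Sum.inr c)
  invFun t := match t with
    | Sum.inl a => Sum.inl ⟨Sum.inl a, Sum.inl_ne_inr⟩
    | Sum.inr (Sum.inl b) => Sum.inl ⟨Sum.inr b.1, fun e => b.2 (Sum.inr_injective e)⟩
    | Sum.inr (Sum.inr c) => Sum.inr c
  left_inv := by
    rintro (⟨a | b, h⟩ | c) <;> rfl
  right_inv := by
    rintro (a | b | c) <;> rfl

/-- The identification of the label sets of `(A ∘ₓ B) ∘_y C` and `(A ∘_y C) ∘ₓ B`,
for `x ≠ y` two labels of `A`. -/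
def par {I : Type} (x y : I) (hyx : y ≠ x) (hxy : x ≠ y) (J K : Type) :
    Ins (Sum.inl ⟨y, hyx⟩ : Ins x J) K ≃ Ins (Sum.inl ⟨x, hxy⟩ : Ins y K) J where
  toFun t := match t with
    | Sum.inl ⟨Sum.inl a, h⟩ =>
        Sum.inl ⟨Sum.inl ⟨a.1, fun e => h (congrArg Sum.inl (Subtype.ext e))⟩,
          fun e => a.2 (congrArg Subtype.val (Sum.inl_injective e))⟩
    | Sum.inl ⟨Sum.inr b, _⟩ => Sum.inr b
    | Sum.inr c => Sum.inl ⟨Sum.inr c, Sum.inr_ne_inl⟩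
  invFun t := match t with
    | Sum.inl ⟨Sum.inl a, h⟩ =>
        Sum.inl ⟨Sum.inl ⟨a.1, fun e => h (congrArg Sum.inl (Subtype.ext e))⟩,
          fun e => a.2 (congrArg Subtype.val (Sum.inl_injective e))⟩
    | Sum.inl ⟨Sum.inr c, _⟩ => Sum.inr c
    | Sum.inr b => Sum.inl ⟨Sum.inr b, Sum.inr_ne_inl⟩
  left_inv := by
    rintro (⟨a | b, h⟩ | c) <;> rfl
  right_inv := by
    rintro (⟨a | b, h⟩ | c) <;> rfl

/-- The map `(I ∖ {x}) ⊔ J → I` which collapses the block `J` to `x`. -/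
def collapse {I : Type} (x : I) (J : Type) : Ins x J → I :=
  Sum.elim (fun a => a.1) (fun _ => x)

theorem collapse_surjective {I : Type} (x : I) (J : Type) [Nonempty J] :
    Function.Surjective (collapse x J) := by
  intro a
  by_cases h : a = x
  · exact ⟨Sum.inr (Classical.arbitrary J), h.symm⟩
  · exact ⟨Sum.inl ⟨a, h⟩, rfl⟩

end Ins

universe u v

/-- The data of a symmetric set-operad: sets `P(I)` for nonempty finite sets `I`, relabelling
along bijections, a unit, and partial compositions `∘ₓ : P(I) × P(J) → P((I ∖ {x}) ⊔ J)`. -/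
structure SymOperadData : Type (max 1 (u + 1)) where
  obj : (I : Type) → [Finite I] → [Nonempty I] → Type u
  map : {I J : Type} → [Finite I] → [Nonempty I] → [Finite J] → [Nonempty J] →
    (I ≃ J) → obj I → obj J
  one : obj Unit
  comp : {I J : Type} → [Finite I] → [Nonempty I] → [Finite J] → [Nonempty J] →
    (x : I) → obj I → obj J → obj (Ins x J)

namespace SymOperadData

/-- The axioms of a symmetric operad. -/
structure IsSymmetricOperad (P : SymOperadData.{u}) : Prop where
  map_refl : ∀ {I : Type} [Finite I] [Nonempty I] (A : P.obj I), P.map (Equiv.refl I) A = A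
  map_trans : ∀ {I J K : Type} [Finite I] [Nonempty I] [Finite J] [Nonempty J] [Finite K]
    [Nonempty K] (f : I ≃ J) (g : J ≃ K) (A : P.obj I),
    P.map (f.trans g) A = P.map g (P.map f A)
  comp_natural : ∀ {I I' J J' : Type} [Finite I] [Nonempty I] [Finite I'] [Nonempty I']
    [Finite J] [Nonempty J] [Finite J'] [Nonempty J'] (f : I ≃ I') (g : J ≃ J') (x : I)
    (A : P.obj I) (B : P.obj J),
    P.comp (f x) (P.map f A) (P.map g B) = P.map (Ins.congr f g x) (P.comp x A B)
  one_comp : ∀ {J : Type} [Finite J] [Nonempty J] (B : P.obj J),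
    P.map (Ins.unitLeft J) (P.comp () P.one B) = B
  comp_one : ∀ {I : Type} [Finite I] [Nonempty I] (x : I) (A : P.obj I),
    P.map (Ins.unitRight x) (P.comp x A P.one) = A
  comp_seq : ∀ {I J K : Type} [Finite I] [Nonempty I] [Finite J] [Nonempty J] [Finite K]
    [Nonempty K] (x : I) (y : J) (A : P.obj I) (B : P.obj J) (C : P.obj K),
    P.map (Ins.seq x y K) (P.comp (Sum.inr y : Ins x J) (P.comp x A B) C) =
      P.comp x A (P.comp y B C)
  comp_par : ∀ {I J K : Type} [Finite I] [Nonempty I] [Finite J] [Nonempty J] [Finite K]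
    [Nonempty K] (x y : I) (hyx : y ≠ x) (hxy : x ≠ y) (A : P.obj I) (B : P.obj J)
    (C : P.obj K),
    P.map (Ins.par x y hyx hxy J K) (P.comp (Sum.inl ⟨y, hyx⟩ : Ins x J) (P.comp x A B) C) =
      P.comp (Sum.inl ⟨x, hxy⟩ : Ins y K) (P.comp y A C) B

/-- An isomorphism of symmetric operads: bijections `P(I) ≃ Q(I)` compatible with relabelling,
units and partial compositions. -/
structure Iso (P : SymOperadData.{u}) (Q : SymOperadData.{v}) where
  equiv : (I : Type) → [Finite I] → [Nonempty I] → P.obj I ≃ Q.obj I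
  map_comm : ∀ {I J : Type} [Finite I] [Nonempty I] [Finite J] [Nonempty J] (f : I ≃ J)
    (A : P.obj I), equiv J (P.map f A) = Q.map f (equiv I A)
  one_comm : equiv Unit P.one = Q.one
  comp_comm : ∀ {I J : Type} [Finite I] [Nonempty I] [Finite J] [Nonempty J] (x : I)
    (A : P.obj I) (B : P.obj J),
    equiv (Ins x J) (P.comp x A B) = Q.comp x (equiv I A) (equiv J B)

/-- The Hadamard product: componentwise operations on pairs. -/
def hadamard (P : SymOperadData.{u}) (Q : SymOperadData.{u}) : SymOperadData.{u} where
  obj I _ _ := P.obj I × Q.obj I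
  map f A := (P.map f A.1, Q.map f A.2)
  one := (P.one, Q.one)
  comp x A B := (P.comp x A.1 B.1, Q.comp x A.2 B.2)

/-- The elements of the symmetric sub-operad generated by a set `G` of elements of arity two. -/
inductive Generated (P : SymOperadData.{u}) (G : Set (P.obj (Fin 2))) :
    (I : Type) → [Finite I] → [Nonempty I] → P.obj I → Prop
  | one : Generated P G Unit P.one
  | gen (A : P.obj (Fin 2)) (hA : A ∈ G) : Generated P G (Fin 2) A
  | map {I J : Type} [Finite I] [Nonempty I] [Finite J] [Nonempty J] (f : I ≃ J)
      (A : P.obj I) (hA : Generated P G I A) : Generated P G J (P.map f A)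
  | comp {I J : Type} [Finite I] [Nonempty I] [Finite J] [Nonempty J] (x : I)
      (A : P.obj I) (B : P.obj J) (hA : Generated P G I A) (hB : Generated P G J B) :
      Generated P G (Ins x J) (P.comp x A B)

/-- The symmetric sub-operad of `P` generated by a set `G` of elements of arity two. -/
def generate (P : SymOperadData.{u}) (G : Set (P.obj (Fin 2))) : SymOperadData.{u} where
  obj I _ _ := {A : P.obj I // P.Generated G I A}
  map f A := ⟨P.map f A.1, .map f A.1 A.2⟩
  one := ⟨P.one, .one⟩
  comp x A B := ⟨P.comp x A.1 B.1, .comp x A.1 B.1 A.2 B.2⟩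

end SymOperadData

/-! ### Monomials and formal fractions -/

/-- The symbols `[S]`, for `S` a nonempty subset of `I`. -/
abbrev FSymbol (I : Type) : Type := {S : Set I // S.Nonempty}

namespace FSymbol

/-- The symbol of the full label set. -/
def full (I : Type) [Nonempty I] : FSymbol I := ⟨Set.univ, Set.univ_nonempty⟩

/-- Renaming `[S] ↦ [f(S)]`. -/
def image {I J : Type} (f : I → J) (S : FSymbol I) : FSymbol J := ⟨f '' S.1, S.2.image f⟩

/-- Substituting the set `J` for `x` in the symbol `[S]`. -/
def subst {I : Type} (x : I) (J : Type) [Nonempty J] (S : FSymbol I) : FSymbol (Ins x J) :=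
  ⟨Ins.collapse x J ⁻¹' S.1, S.2.preimage (Ins.collapse_surjective x J)⟩

end FSymbol

/-- The symmetric operad of monomials in the variables `(u_a)`, `a ∈ I`. A monomial is given by
its exponents; the composition substitutes the product of the `u_b`, `b ∈ J`, for `u_x` in the
first monomial, and multiplies by the second one. -/
def monOperad : SymOperadData.{0} where
  obj I _ _ := I → ℕ
  map f m := m ∘ f.symm
  one := 0
  comp x m m' := fun t => m (Ins.collapse x _ t) + Sum.elim (fun _ => 0) m' t

/-- The symmetric operad of formal fractions. A simplified fraction of products of symbols is
given by its integer exponents, so that products of fractions are written additively here: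
`F ∘ₓ G = [J] · F(x := J) · G`. The unit is `1/[∗]`. -/
noncomputable def ffOperad : SymOperadData.{0} where
  obj I _ _ := FSymbol I →₀ ℤ
  map f F := F.mapDomain (FSymbol.image f)
  one := -Finsupp.single (FSymbol.full Unit) 1
  comp {_ J} _ _ _ _ x F G :=
    Finsupp.single (FSymbol.image Sum.inr (FSymbol.full J)) 1
      + F.mapDomain (FSymbol.subst x J)
      + G.mapDomain (FSymbol.image Sum.inr)

/-- The symmetric operad of formal fractions with monomials. -/
noncomputable def mffOperad : SymOperadData.{0} := monOperad.hadamard ffOperad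

/-- The symbol `[1]` (the labels `1, 2` are the elements `0, 1` of `Fin 2`). -/
noncomputable def sym1 : FSymbol (Fin 2) →₀ ℤ :=
  Finsupp.single ⟨{0}, Set.singleton_nonempty _⟩ 1

/-- The symbol `[2]`. -/
noncomputable def sym2 : FSymbol (Fin 2) →₀ ℤ :=
  Finsupp.single ⟨{1}, Set.singleton_nonempty _⟩ 1

/-- The symbol `[12]`. -/
noncomputable def sym12 : FSymbol (Fin 2) →₀ ℤ :=
  Finsupp.single ⟨{0, 1}, Set.insert_nonempty _ _⟩ 1

/-- The six generators
`1/([1][12])`, `1/([2][12])`, `1/[12]`, `1/([1][2])`, `u₁/([1][12])`, `u₂/([2][12])`. -/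
noncomputable def ff6Generators : Set (mffOperad.obj (Fin 2)) :=
  {((0 : Fin 2 → ℕ), -sym1 - sym12),
   ((0 : Fin 2 → ℕ), -sym2 - sym12),
   ((0 : Fin 2 → ℕ), -sym12),
   ((0 : Fin 2 → ℕ), -sym1 - sym2),
   (![1, 0], -sym1 - sym12),
   (![0, 1], -sym2 - sym12)}

/-- The symmetric operad `FF₆^Σ`. -/
noncomputable def ff6Operad : SymOperadData.{0} := mffOperad.generate ff6Generators

/-! ### Dotted red and white trees -/

/-- A dotted red and white tree labelled by `I`: a finite rooted tree, with the nodes carrying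
the labels of `I`. The node of each label is recorded, so a node can have no label, one, or
several labels, and each label is used exactly once. -/
structure DottedTree (I : Type) : Type 1 where
  /-- the nodes -/
  V : Type
  finite : Finite V
  root : V
  parent : V → Option V
  parent_eq_none : ∀ v, parent v = none ↔ v = root
  wf : WellFounded fun p c => parent c = some p
  /-- the node which carries a given label -/
  node : I → V
  /-- a node without labels has at least two children -/
  two_children : ∀ v, (∀ i, node i ≠ v) →
    ∃ a b, a ≠ b ∧ parent a = some v ∧ parent b = some v
  /-- the red nodes; the others are white -/
  red : V → Prop
  /-- a node is red exactly when it has no label and all its children are white -/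
  red_iff : ∀ v, red v ↔ (∀ i, node i ≠ v) ∧ ∀ c, parent c = some v → ¬ red c
  /-- `dotted v` says that there is a dot on the edge between `v` and its parent -/
  dotted : V → Prop
  /-- dots are only put on edges between white nodes -/
  dotted_white : ∀ v, dotted v → ∃ p, parent v = some p ∧ ¬ red p ∧ ¬ red v

namespace DottedTree

variable {I J : Type}

/-- Isomorphism of labelled dotted trees. -/
structure TreeIso (T T' : DottedTree I) where
  e : T.V ≃ T'.V
  parent_comm : ∀ v, T'.parent (e v) = (T.parent v).map e
  node_comm : ∀ i, T'.node i = e (T.node i)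
  red_comm : ∀ v, T'.red (e v) ↔ T.red v
  dotted_comm : ∀ v, T'.dotted (e v) ↔ T.dotted v

namespace TreeIso

def refl (T : DottedTree I) : TreeIso T T :=
  ⟨Equiv.refl _, by simp, by simp, by simp, by simp⟩

def symm {T T' : DottedTree I} (f : TreeIso T T') : TreeIso T' T where
  e := f.e.symm
  parent_comm v := by
    obtain ⟨w, rfl⟩ := f.e.surjective v
    simp [f.parent_comm]
  node_comm i := by simp [f.node_comm]
  red_comm v := by rw [← f.red_comm]; simp
  dotted_comm v := by rw [← f.dotted_comm]; simp

def trans {T T' T'' : DottedTree I} (f : TreeIso T T') (g : TreeIso T' T'') :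
    TreeIso T T'' where
  e := f.e.trans g.e
  parent_comm v := by simp [f.parent_comm, g.parent_comm]
  node_comm i := by simp [f.node_comm, g.node_comm]
  red_comm v := by simp [f.red_comm, g.red_comm]
  dotted_comm v := by simp [f.dotted_comm, g.dotted_comm]

theorem root_comm {T T' : DottedTree I} (f : TreeIso T T') : T'.root = f.e T.root := by
  symm
  rw [← T'.parent_eq_none, f.parent_comm, (T.parent_eq_none _).2 rfl]
  rfl

theorem parent_some {T T' : DottedTree I} (f : TreeIso T T') (c p : T.V) :
    T'.parent (f.e c) = some (f.e p) ↔ T.parent c = some p := by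
  simp [f.parent_comm]

end TreeIso

instance setoid (I : Type) : Setoid (DottedTree I) where
  r T T' := Nonempty (TreeIso T T')
  iseqv := ⟨fun T => ⟨.refl T⟩, fun ⟨f⟩ => ⟨f.symm⟩, fun ⟨f⟩ ⟨g⟩ => ⟨f.trans g⟩⟩

/-- Relabelling along a bijection. -/
def relabel (f : I ≃ J) (T : DottedTree I) : DottedTree J where
  V := T.V
  finite := T.finite
  root := T.root
  parent := T.parent
  parent_eq_none := T.parent_eq_none
  wf := T.wf
  node j := T.node (f.symm j)
  two_children v h := T.two_children v fun i => by simpa using h (f i)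
  red := T.red
  red_iff v := by
    rw [T.red_iff, f.symm.forall_congr_left (p := fun j => T.node (f.symm j) ≠ v)]
    simp
  dotted := T.dotted
  dotted_white := T.dotted_white

/-- The tree with a single node and a single label. -/
def single : DottedTree Unit where
  V := Unit
  finite := inferInstance
  root := ()
  parent _ := none
  parent_eq_none := by simp
  wf := ⟨fun a => ⟨_, fun _ h => by simp at h⟩⟩
  node _ := ()
  two_children v h := absurd rfl (h ())
  red _ := False
  red_iff v := by simp
  dotted _ := False
  dotted_white := by simp

theorem parent_ne_self (T : DottedTree I) (v : T.V) : T.parent v ≠ some v := fun h =>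
  T.wf.irrefl.irrefl v h

theorem parent_root (T : DottedTree I) : T.parent T.root = none := (T.parent_eq_none _).2 rfl

theorem not_red_node (T : DottedTree I) (i : I) : ¬ T.red (T.node i) := fun h =>
  ((T.red_iff _).1 h).1 i rfl

/-- `v` is a leaf. -/
def IsLeaf (T : DottedTree I) (v : T.V) : Prop := ∀ c, T.parent c ≠ some v

theorem eq_root_of_isLeaf (T : DottedTree I) (h : T.IsLeaf T.root) (v : T.V) : v = T.root := by
  induction v using T.wf.induction with
  | _ v ih =>
    cases hp : T.parent v with
    | none => exact (T.parent_eq_none v).1 hp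
    | some p =>
      have := ih p hp
      subst this
      exact absurd hp (h v)

open Classical in
/-- Where a node `w` of `T₂` goes when the root of `T₂` is replaced by the node `z`. -/
noncomputable def place {W : Type} (z : W) (T₂ : DottedTree J) (w : T₂.V) :
    W ⊕ {w : T₂.V // w ≠ T₂.root} :=
  if h : w = T₂.root then Sum.inl z else Sum.inr ⟨w, h⟩

theorem place_eq_inl {W : Type} {z : W} {T₂ : DottedTree J} {w : T₂.V} {v : W} :
    place z T₂ w = Sum.inl v ↔ w = T₂.root ∧ v = z := by
  unfold place
  split <;> simp_all [eq_comm]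

theorem place_eq_inr {W : Type} {z : W} {T₂ : DottedTree J} {w : T₂.V}
    {v : {w : T₂.V // w ≠ T₂.root}} : place z T₂ w = Sum.inr v ↔ w = v.1 := by
  unfold place
  split
  · next h =>
    subst h
    simpa using v.2.symm
  · simp [Subtype.ext_iff]

theorem exists_parent (T : DottedTree I) {v : T.V} (h : v ≠ T.root) :
    ∃ p, T.parent v = some p :=
  Option.ne_none_iff_exists'.1 fun e => h ((T.parent_eq_none v).1 e)

/-- Rule (W), for `T₂` with a white root: the label `x` is erased from its node `z`, the labels
of the root of `T₂` are added to `z`, and the children of the root of `T₂` become children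
of `z`, with the same dots. -/
noncomputable def compW (T₁ : DottedTree I) (x : I) (T₂ : DottedTree J)
    (hr : ¬ T₂.red T₂.root) : DottedTree (Ins x J) where
  V := T₁.V ⊕ {w : T₂.V // w ≠ T₂.root}
  finite := by
    have := T₁.finite
    have := T₂.finite
    infer_instance
  root := Sum.inl T₁.root
  parent := Sum.elim (fun v => (T₁.parent v).map Sum.inl)
    (fun w => (T₂.parent w.1).map (place (T₁.node x) T₂))
  parent_eq_none := by
    rintro (v | ⟨w, hw⟩)
    · simp [T₁.parent_eq_none]
    · simp [T₂.parent_eq_none, hw]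
  wf := by
    have h1 : ∀ v : T₁.V, Acc (fun p c : T₁.V ⊕ {w : T₂.V // w ≠ T₂.root} =>
        Sum.elim (fun v => (T₁.parent v).map Sum.inl)
          (fun w : {w : T₂.V // w ≠ T₂.root} =>
            (T₂.parent w.1).map (place (T₁.node x) T₂)) c = some p) (Sum.inl v) := by
      intro v
      induction v using T₁.wf.induction with
      | _ v ih =>
        refine ⟨_, ?_⟩
        rintro (p | p) h
        · exact ih p (by simpa using h)
        · simp at h
    refine ⟨?_⟩
    rintro (v | ⟨w, hw⟩)
    · exact h1 v
    · induction w using T₂.wf.induction with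
      | _ w ih =>
        refine ⟨_, ?_⟩
        rintro (p | ⟨p, hp⟩) h
        · exact h1 p
        · refine ih p ?_ hp
          simpa [place_eq_inr] using h
  node := Sum.elim (fun a => Sum.inl (T₁.node a.1)) (fun j => place (T₁.node x) T₂ (T₂.node j))
  two_children := by
    rintro (v | ⟨w, hw⟩) h
    · by_cases hv : v = T₁.node x
      · subst hv
        obtain ⟨a, b, hab, ha, hb⟩ := T₂.two_children T₂.root fun j hj =>
          h (Sum.inr j) (by simp [place_eq_inl, hj])
        have ha' : a ≠ T₂.root := by rintro rfl; exact T₂.parent_ne_self _ ha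
        have hb' : b ≠ T₂.root := by rintro rfl; exact T₂.parent_ne_self _ hb
        refine ⟨Sum.inr ⟨a, ha'⟩, Sum.inr ⟨b, hb'⟩, by simpa using hab, ?_, ?_⟩
        · simp [ha, place_eq_inl]
        · simp [hb, place_eq_inl]
      · obtain ⟨a, b, hab, ha, hb⟩ := T₁.two_children v fun i hi => by
          by_cases hx : i = x
          · subst hx; exact hv hi.symm
          · exact h (Sum.inl ⟨i, hx⟩) (by simp [hi])
        exact ⟨Sum.inl a, Sum.inl b, by simpa using hab, by simp [ha], by simp [hb]⟩
    · obtain ⟨a, b, hab, ha, hb⟩ := T₂.two_children w fun j hj =>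
        h (Sum.inr j) (by simp [place_eq_inr, hj])
      have ha' : a ≠ T₂.root := by rintro rfl; simp [T₂.parent_root] at ha
      have hb' : b ≠ T₂.root := by rintro rfl; simp [T₂.parent_root] at hb
      refine ⟨Sum.inr ⟨a, ha'⟩, Sum.inr ⟨b, hb'⟩, by simpa using hab, ?_, ?_⟩
      · simp [ha, place_eq_inr]
      · simp [hb, place_eq_inr]
  red := Sum.elim T₁.red (fun w => T₂.red w.1)
  red_iff := by
    rintro (v | ⟨w, hw⟩)
    · by_cases hv : v = T₁.node x
      · subst hv
        refine iff_of_false (T₁.not_red_node x) ?_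
        rintro ⟨h, hc⟩
        refine hr ((T₂.red_iff _).2 ⟨fun j hj => h (Sum.inr j) (by simp [place_eq_inl, hj]),
          fun c hcr => ?_⟩)
        refine hc (Sum.inr ⟨c, ?_⟩) (by simp [hcr, place_eq_inl])
        rintro rfl; exact T₂.parent_ne_self _ hcr
      · simp only [Sum.elim_inl]
        rw [T₁.red_iff]
        constructor
        · rintro ⟨h, hc⟩
          constructor
          · rintro (a | j)
            · simpa using h a.1
            · simp [place_eq_inl, hv]
          · rintro (c | c) hcp
            · exact hc c (by simpa using hcp)
            · simp [place_eq_inl, hv] at hcp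
        · rintro ⟨h, hc⟩
          refine ⟨fun i hi => ?_, fun c hcp => hc (Sum.inl c) (by simp [hcp])⟩
          by_cases hx : i = x
          · subst hx; exact hv hi.symm
          · exact h (Sum.inl ⟨i, hx⟩) (by simp [hi])
    · simp only [Sum.elim_inr]
      rw [T₂.red_iff]
      constructor
      · rintro ⟨h, hc⟩
        constructor
        · rintro (a | j)
          · simp
          · simpa [place_eq_inr] using h j
        · rintro (c | c) hcp
          · simp at hcp
          · exact hc c.1 (by simpa [place_eq_inr] using hcp)
      · rintro ⟨h, hc⟩
        refine ⟨fun j hj => h (Sum.inr j) (by simp [place_eq_inr, hj]), fun c hcp => ?_⟩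
        refine hc (Sum.inr ⟨c, ?_⟩) (by simp [hcp, place_eq_inr])
        rintro rfl; simp [T₂.parent_root] at hcp
  dotted := Sum.elim T₁.dotted (fun w => T₂.dotted w.1)
  dotted_white := by
    rintro (v | ⟨w, hw⟩) h
    · obtain ⟨p, hp, h1, h2⟩ := T₁.dotted_white v h
      exact ⟨Sum.inl p, by simp [hp], h1, h2⟩
    · obtain ⟨p, hp, h1, h2⟩ := T₂.dotted_white w h
      by_cases hpr : p = T₂.root
      · exact ⟨Sum.inl (T₁.node x), by simp [hp, place_eq_inl, hpr], T₁.not_red_node x, h2⟩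
      · exact ⟨Sum.inr ⟨p, hpr⟩, by simp [hp, place_eq_inr], h1, h2⟩

/-- `T` is the tree with only one node, labelled `{x}`. -/
def IsSingle (T : DottedTree I) (x : I) : Prop := (∀ v, v = T.node x) ∧ ∀ a, a = x

/-- Rule (R1), where `T₁` is the tree with one node labelled `x`: the result is `T₂`. -/
def compR1 (x : I) (T₂ : DottedTree J) (hx : ∀ a : I, a = x) : DottedTree (Ins x J) where
  V := T₂.V
  finite := T₂.finite
  root := T₂.root
  parent := T₂.parent
  parent_eq_none := T₂.parent_eq_none
  wf := T₂.wf
  node := Sum.elim (fun a => absurd (hx a.1) a.2) T₂.node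
  two_children v h := T₂.two_children v fun j => h (Sum.inr j)
  red := T₂.red
  red_iff v := by
    rw [T₂.red_iff]
    refine and_congr_left fun _ => ⟨fun h => ?_, fun h j => h (Sum.inr j)⟩
    rintro (a | j)
    · exact absurd (hx a.1) a.2
    · exact h j
  dotted := T₂.dotted
  dotted_white := T₂.dotted_white

/-- Rule (R2), for `T₂` with a red root, when the node `z` of `x` is not a leaf or has several
labels: the label `x` is erased from `z`, and the root of `T₂` is glued as a new child of `z`. -/
def compR2 (T₁ : DottedTree I) (x : I) (T₂ : DottedTree J) (hr : T₂.red T₂.root)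
    (hz : ¬ T₁.IsLeaf (T₁.node x) ∨ ∃ a, a ≠ x ∧ T₁.node a = T₁.node x) :
    DottedTree (Ins x J) where
  V := T₁.V ⊕ T₂.V
  finite := by
    have := T₁.finite
    have := T₂.finite
    infer_instance
  root := Sum.inl T₁.root
  parent := Sum.elim (fun v => (T₁.parent v).map Sum.inl)
    (fun w => some ((T₂.parent w).elim (Sum.inl (T₁.node x)) Sum.inr))
  parent_eq_none := by
    rintro (v | w)
    · simp [T₁.parent_eq_none]
    · simp
  wf := by
    have h1 : ∀ v : T₁.V, Acc (fun p c : T₁.V ⊕ T₂.V =>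
        Sum.elim (fun v => (T₁.parent v).map Sum.inl)
          (fun w => some ((T₂.parent w).elim (Sum.inl (T₁.node x)) Sum.inr)) c = some p)
          (Sum.inl v) := by
      intro v
      induction v using T₁.wf.induction with
      | _ v ih =>
        refine ⟨_, ?_⟩
        rintro (p | p) h
        · exact ih p (by simpa using h)
        · simp at h
    refine ⟨?_⟩
    rintro (v | w)
    · exact h1 v
    · induction w using T₂.wf.induction with
      | _ w ih =>
        refine ⟨_, ?_⟩
        rintro (p | p) h
        · exact h1 p
        · refine ih p ?_
          cases hw : T₂.parent w <;> simp_all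
  node := Sum.elim (fun a => Sum.inl (T₁.node a.1)) (fun j => Sum.inr (T₂.node j))
  two_children := by
    rintro (v | w) h
    · by_cases hv : v = T₁.node x
      · subst hv
        rcases hz with hz | ⟨a, hax, ha⟩
        · obtain ⟨c, hc⟩ : ∃ c, T₁.parent c = some (T₁.node x) := by
            simpa [IsLeaf] using hz
          exact ⟨Sum.inl c, Sum.inr T₂.root, by simp, by simp [hc], by simp [T₂.parent_root]⟩
        · exact absurd (by simp [ha]) (h (Sum.inl ⟨a, hax⟩))
      · obtain ⟨a, b, hab, ha, hb⟩ := T₁.two_children v fun i hi => by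
          by_cases hx : i = x
          · subst hx; exact hv hi.symm
          · exact h (Sum.inl ⟨i, hx⟩) (by simp [hi])
        exact ⟨Sum.inl a, Sum.inl b, by simpa using hab, by simp [ha], by simp [hb]⟩
    · obtain ⟨a, b, hab, ha, hb⟩ := T₂.two_children w fun j hj =>
        h (Sum.inr j) (by simp [hj])
      exact ⟨Sum.inr a, Sum.inr b, by simpa using hab, by simp [ha], by simp [hb]⟩
  red := Sum.elim T₁.red T₂.red
  red_iff := by
    rintro (v | w)
    · by_cases hv : v = T₁.node x
      · subst hv
        refine iff_of_false (T₁.not_red_node x) ?_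
        rintro ⟨-, hc⟩
        exact hc (Sum.inr T₂.root) (by simp [T₂.parent_root]) hr
      · simp only [Sum.elim_inl]
        rw [T₁.red_iff]
        constructor
        · rintro ⟨h, hc⟩
          constructor
          · rintro (a | j)
            · simpa using h a.1
            · simp
          · rintro (c | c) hcp
            · exact hc c (by simpa using hcp)
            · cases hw : T₂.parent c <;> simp_all [eq_comm]
        · rintro ⟨h, hc⟩
          refine ⟨fun i hi => ?_, fun c hcp => hc (Sum.inl c) (by simp [hcp])⟩
          by_cases hx : i = x
          · subst hx; exact hv hi.symm
          · exact h (Sum.inl ⟨i, hx⟩) (by simp [hi])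
    · simp only [Sum.elim_inr]
      rw [T₂.red_iff]
      constructor
      · rintro ⟨h, hc⟩
        constructor
        · rintro (a | j)
          · simp
          · simpa using h j
        · rintro (c | c) hcp
          · simp at hcp
          · refine hc c ?_
            cases hw : T₂.parent c <;> simp_all
      · rintro ⟨h, hc⟩
        exact ⟨fun j hj => h (Sum.inr j) (by simp [hj]),
          fun c hcp => hc (Sum.inr c) (by simp [hcp])⟩
  dotted := Sum.elim T₁.dotted T₂.dotted
  dotted_white := by
    rintro (v | w) h
    · obtain ⟨p, hp, h1, h2⟩ := T₁.dotted_white v h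
      exact ⟨Sum.inl p, by simp [hp], h1, h2⟩
    · obtain ⟨p, hp, h1, h2⟩ := T₂.dotted_white w h
      exact ⟨Sum.inr p, by simp [hp], h1, h2⟩

open Classical in
/-- A node `v` of `T` other than `z`, as a node of `T` with `z` removed. It is only applied to
nodes `v ≠ z`; the value `z'` at `z` is irrelevant. -/
noncomputable def avoid (T : DottedTree I) (z : T.V) (z' : {v : T.V // v ≠ z}) (v : T.V) :
    {v : T.V // v ≠ z} :=
  if h : v = z then z' else ⟨v, h⟩

theorem avoid_eq {T : DottedTree I} {z : T.V} {z' : {v : T.V // v ≠ z}} {v : T.V} (hv : v ≠ z)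
    {w : {v : T.V // v ≠ z}} : avoid T z z' v = w ↔ v = w.1 := by
  simp [avoid, hv, Subtype.ext_iff]

/-- Rule (R3), for `T₂` with a red root, when the node `z` of `x` is a leaf with `x` as its only
label, and has a parent `z'`: the leaf `z` is removed, and the children of the root of `T₂`
become children of `z'`. The new edges are dotted if the edge from `z'` to `z` is, and not
dotted otherwise. -/
noncomputable def compR3 (T₁ : DottedTree I) (x : I) (T₂ : DottedTree J)
    (hr : T₂.red T₂.root) (hl : T₁.IsLeaf (T₁.node x))
    (hx : ∀ a, T₁.node a = T₁.node x → a = x) (z' : {v : T₁.V // v ≠ T₁.node x})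
    (hz' : T₁.parent (T₁.node x) = some z'.1) : DottedTree (Ins x J) where
  V := {v : T₁.V // v ≠ T₁.node x} ⊕ {w : T₂.V // w ≠ T₂.root}
  finite := by
    have := T₁.finite
    have := T₂.finite
    infer_instance
  root := Sum.inl ⟨T₁.root, fun h => by simp [← h, T₁.parent_root] at hz'⟩
  parent := Sum.elim
    (fun v => (T₁.parent v.1).map fun p => Sum.inl (avoid T₁ (T₁.node x) z' p))
    (fun w => (T₂.parent w.1).map (place z' T₂))
  parent_eq_none := by
    rintro (⟨v, hv⟩ | ⟨w, hw⟩)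
    · simp [T₁.parent_eq_none]
    · simp [T₂.parent_eq_none, hw]
  wf := by
    have hne : ∀ v p, T₁.parent v = some p → p ≠ T₁.node x := by
      rintro v p h rfl; exact hl v h
    have h1 : ∀ v (hv : v ≠ T₁.node x),
        Acc (fun p c : {v : T₁.V // v ≠ T₁.node x} ⊕ {w : T₂.V // w ≠ T₂.root} =>
        Sum.elim (fun v => (T₁.parent v.1).map fun p => Sum.inl (avoid T₁ (T₁.node x) z' p))
          (fun w => (T₂.parent w.1).map (place z' T₂)) c = some p) (Sum.inl ⟨v, hv⟩) := by
      intro v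
      induction v using T₁.wf.induction with
      | _ v ih =>
        intro hv
        refine ⟨_, ?_⟩
        rintro (⟨p, hp⟩ | p) h
        · refine ih p ?_ hp
          simp only [Sum.elim_inl, Option.map_eq_some_iff, Sum.inl.injEq] at h
          obtain ⟨q, hq, hqp⟩ := h
          rw [avoid_eq (hne _ _ hq)] at hqp
          rw [hq, hqp]
        · simp at h
    refine ⟨?_⟩
    rintro (⟨v, hv⟩ | ⟨w, hw⟩)
    · exact h1 v hv
    · induction w using T₂.wf.induction with
      | _ w ih =>
        refine ⟨_, ?_⟩
        rintro (⟨p, hp⟩ | ⟨p, hp⟩) h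
        · exact h1 p hp
        · refine ih p ?_ hp
          simpa [place_eq_inr] using h
  node := Sum.elim (fun a => Sum.inl ⟨T₁.node a.1, fun h => a.2 (hx _ h)⟩)
    (fun j => Sum.inr ⟨T₂.node j, fun h => T₂.not_red_node j (h ▸ hr)⟩)
  two_children := by
    have hne : ∀ v p, T₁.parent v = some p → p ≠ T₁.node x := by
      rintro v p h rfl; exact hl v h
    rintro (⟨v, hv⟩ | ⟨w, hw⟩) h
    · by_cases hvz : v = z'.1
      · obtain ⟨a, b, hab, ha, hb⟩ := T₂.two_children T₂.root ((T₂.red_iff _).1 hr).1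
        have ha' : a ≠ T₂.root := by rintro rfl; exact T₂.parent_ne_self _ ha
        have hb' : b ≠ T₂.root := by rintro rfl; exact T₂.parent_ne_self _ hb
        refine ⟨Sum.inr ⟨a, ha'⟩, Sum.inr ⟨b, hb'⟩, by simpa using hab, ?_, ?_⟩
        · simp [ha, place_eq_inl, hvz]
        · simp [hb, place_eq_inl, hvz]
      · obtain ⟨a, b, hab, ha, hb⟩ := T₁.two_children v fun i hi => by
          by_cases hix : i = x
          · subst hix; exact hv hi.symm
          · exact h (Sum.inl ⟨i, hix⟩) (by simp [hi])
        have ha' : a ≠ T₁.node x := by rintro rfl; rw [hz'] at ha; exact hvz (Option.some_injective _ ha).symm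
        have hb' : b ≠ T₁.node x := by rintro rfl; rw [hz'] at hb; exact hvz (Option.some_injective _ hb).symm
        refine ⟨Sum.inl ⟨a, ha'⟩, Sum.inl ⟨b, hb'⟩, by simpa using hab, ?_, ?_⟩
        · simp [ha, avoid_eq hv]
        · simp [hb, avoid_eq hv]
    · obtain ⟨a, b, hab, ha, hb⟩ := T₂.two_children w fun j hj =>
        h (Sum.inr j) (by simp [hj])
      have ha' : a ≠ T₂.root := by rintro rfl; simp [T₂.parent_root] at ha
      have hb' : b ≠ T₂.root := by rintro rfl; simp [T₂.parent_root] at hb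
      refine ⟨Sum.inr ⟨a, ha'⟩, Sum.inr ⟨b, hb'⟩, by simpa using hab, ?_, ?_⟩
      · simp [ha, place_eq_inr]
      · simp [hb, place_eq_inr]
  red := Sum.elim (fun v => T₁.red v.1) (fun w => T₂.red w.1)
  red_iff := by
    have hne : ∀ v p, T₁.parent v = some p → p ≠ T₁.node x := by
      rintro v p h rfl; exact hl v h
    rintro (⟨v, hv⟩ | ⟨w, hw⟩)
    · simp only [Sum.elim_inl]
      rw [T₁.red_iff]
      constructor
      · rintro ⟨h, hc⟩
        constructor
        · rintro (a | j)
          · simpa using h a.1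
          · simp
        · rintro (⟨c, hcz⟩ | ⟨c, hcr⟩) hcp
          · refine hc c ?_
            simp only [Sum.elim_inl, Option.map_eq_some_iff, Sum.inl.injEq] at hcp
            obtain ⟨q, hq, hqp⟩ := hcp
            rw [avoid_eq (hne _ _ hq)] at hqp
            rw [hq, hqp]
          · simp only [Sum.elim_inr, Option.map_eq_some_iff, place_eq_inl] at hcp
            obtain ⟨q, hq, rfl, -⟩ := hcp
            exact ((T₂.red_iff _).1 hr).2 c hq
      · rintro ⟨h, hc⟩
        refine ⟨fun i hi => ?_, fun c hcp => ?_⟩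
        · by_cases hix : i = x
          · subst hix; exact hv hi.symm
          · exact h (Sum.inl ⟨i, hix⟩) (by simp [hi])
        · by_cases hcz : c = T₁.node x
          · subst hcz; exact T₁.not_red_node x
          · exact hc (Sum.inl ⟨c, hcz⟩) (by simp [hcp, avoid_eq hv])
    · simp only [Sum.elim_inr]
      rw [T₂.red_iff]
      constructor
      · rintro ⟨h, hc⟩
        constructor
        · rintro (a | j)
          · simp
          · simpa using h j
        · rintro (c | c) hcp
          · simp at hcp
          · exact hc c.1 (by simpa [place_eq_inr] using hcp)
      · rintro ⟨h, hc⟩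
        refine ⟨fun j hj => h (Sum.inr j) (by simp [hj]), fun c hcp => ?_⟩
        refine hc (Sum.inr ⟨c, ?_⟩) (by simp [hcp, place_eq_inr])
        rintro rfl; simp [T₂.parent_root] at hcp
  dotted := Sum.elim (fun v => T₁.dotted v.1)
    (fun w => T₂.dotted w.1 ∨ (T₂.parent w.1 = some T₂.root ∧ T₁.dotted (T₁.node x)))
  dotted_white := by
    rintro (⟨v, hv⟩ | ⟨w, hw⟩) h
    · obtain ⟨p, hp, h1, h2⟩ := T₁.dotted_white v h
      have hpx : p ≠ T₁.node x := by rintro rfl; exact hl v hp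
      exact ⟨Sum.inl ⟨p, hpx⟩, by simp [hp, avoid_eq hpx], h1, h2⟩
    · rcases h with h | ⟨hw, h⟩
      · obtain ⟨p, hp, h1, h2⟩ := T₂.dotted_white w h
        have hpr : p ≠ T₂.root := by rintro rfl; exact h1 hr
        exact ⟨Sum.inr ⟨p, hpr⟩, by simp [hp, place_eq_inr], h1, h2⟩
      · obtain ⟨p, hp, h1, h2⟩ := T₁.dotted_white _ h
        rw [hz'] at hp
        obtain rfl := Option.some_injective _ hp
        exact ⟨Sum.inl z', by simp [hw, place_eq_inl], h1, ((T₂.red_iff _).1 hr).2 w hw⟩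

theorem exists_parent_of_not_isSingle (T : DottedTree I) (x : I) (h1 : ¬ T.IsSingle x)
    (hl : T.IsLeaf (T.node x)) (hx : ∀ a, T.node a = T.node x → a = x) :
    ∃ z' : {v : T.V // v ≠ T.node x}, T.parent (T.node x) = some z'.1 := by
  by_cases hr : T.node x = T.root
  · refine absurd ⟨fun v => ?_, fun a => hx a ?_⟩ h1
    · rw [hr] at hl ⊢
      exact T.eq_root_of_isLeaf hl v
    · rw [hr] at hl ⊢
      exact T.eq_root_of_isLeaf hl _
  · obtain ⟨p, hp⟩ := T.exists_parent hr
    exact ⟨⟨p, fun e => T.parent_ne_self _ (e ▸ hp)⟩, hp⟩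

open Classical in
/-- The composition `T₁ ∘ₓ T₂`. -/
noncomputable def comp (x : I) (T₁ : DottedTree I) (T₂ : DottedTree J) :
    DottedTree (Ins x J) :=
  if hr : T₂.red T₂.root then
    if h1 : T₁.IsSingle x then compR1 x T₂ h1.2
    else if h2 : ¬ T₁.IsLeaf (T₁.node x) ∨ ∃ a, a ≠ x ∧ T₁.node a = T₁.node x then
      compR2 T₁ x T₂ hr h2
    else
      have hl : T₁.IsLeaf (T₁.node x) := not_not.1 fun h => h2 (Or.inl h)
      have hx : ∀ a, T₁.node a = T₁.node x → a = x := fun a ha =>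
        not_not.1 fun h => h2 (Or.inr ⟨a, h, ha⟩)
      have h3 := T₁.exists_parent_of_not_isSingle x h1 hl hx
      compR3 T₁ x T₂ hr hl hx h3.choose h3.choose_spec
  else compW T₁ x T₂ hr

namespace TreeIso

/-- An isomorphism restricts to the nodes other than the root. -/
def neRoot {T T' : DottedTree J} (f : TreeIso T T') :
    {w : T.V // w ≠ T.root} ≃ {w : T'.V // w ≠ T'.root} :=
  f.e.subtypeEquiv fun w => by rw [f.root_comm]; simp

/-- An isomorphism restricts to the nodes other than the node of `x`. -/
def neNode {T T' : DottedTree I} (f : TreeIso T T') (x : I) :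
    {v : T.V // v ≠ T.node x} ≃ {v : T'.V // v ≠ T'.node x} :=
  f.e.subtypeEquiv fun w => by rw [f.node_comm]; simp

theorem place_comm {W W' : Type} {T T' : DottedTree J} (f : TreeIso T T') (g : W ≃ W') (z : W)
    (w : T.V) : place (g z) T' (f.e w) = Equiv.sumCongr g f.neRoot (place z T w) := by
  by_cases h : w = T.root
  · have h' : f.e w = T'.root := by rw [f.root_comm, h]
    rw [place_eq_inl.2 ⟨h, rfl⟩]
    simp [place_eq_inl, h']
  · rw [(place_eq_inr (v := ⟨w, h⟩)).2 rfl]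
    simp [place_eq_inr, neRoot]

theorem isLeaf_comm {T T' : DottedTree I} (f : TreeIso T T') (v : T.V) :
    T'.IsLeaf (f.e v) ↔ T.IsLeaf v := by
  unfold IsLeaf
  rw [← f.e.forall_congr_right]
  simp only [ne_eq, f.parent_some]

theorem isSingle_comm {T T' : DottedTree I} (f : TreeIso T T') (x : I) :
    T'.IsSingle x ↔ T.IsSingle x := by
  unfold IsSingle
  rw [← f.e.forall_congr_right]
  simp [f.node_comm]

variable {T₁ T₁' : DottedTree I} {T₂ T₂' : DottedTree J}

def compW (f : TreeIso T₁ T₁') (g : TreeIso T₂ T₂') (x : I) (hr : ¬ T₂.red T₂.root)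
    (hr' : ¬ T₂'.red T₂'.root) :
    TreeIso (DottedTree.compW T₁ x T₂ hr) (DottedTree.compW T₁' x T₂' hr') where
  e := Equiv.sumCongr f.e g.neRoot
  parent_comm := by
    rintro (v | w)
    · change (T₁'.parent (f.e v)).map Sum.inl =
        ((T₁.parent v).map Sum.inl).map (Equiv.sumCongr f.e g.neRoot)
      simp [f.parent_comm, Function.comp_def]
    · change (T₂'.parent (g.e w.1)).map (place (T₁'.node x) T₂') =
        ((T₂.parent w.1).map (place (T₁.node x) T₂)).map (Equiv.sumCongr f.e g.neRoot)
      rw [g.parent_comm, Option.map_map, Option.map_map, f.node_comm]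
      congr 1
      funext p
      exact g.place_comm f.e (T₁.node x) p
  node_comm := by
    rintro (a | j)
    · exact congrArg Sum.inl (f.node_comm a.1)
    · change place (T₁'.node x) T₂' (T₂'.node j) = _
      rw [f.node_comm, g.node_comm]
      exact g.place_comm f.e _ _
  red_comm := by
    rintro (v | w)
    · exact f.red_comm v
    · exact g.red_comm w.1
  dotted_comm := by
    rintro (v | w)
    · exact f.dotted_comm v
    · exact g.dotted_comm w.1

def compR1 (g : TreeIso T₂ T₂') (x : I) (hx : ∀ a : I, a = x) :
    TreeIso (DottedTree.compR1 x T₂ hx) (DottedTree.compR1 x T₂' hx) where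
  e := g.e
  parent_comm := g.parent_comm
  node_comm := by
    rintro (a | j)
    · exact absurd (hx a.1) a.2
    · exact g.node_comm j
  red_comm := g.red_comm
  dotted_comm := g.dotted_comm

def compR2 (f : TreeIso T₁ T₁') (g : TreeIso T₂ T₂') (x : I) (hr : T₂.red T₂.root)
    (hr' : T₂'.red T₂'.root)
    (hz : ¬ T₁.IsLeaf (T₁.node x) ∨ ∃ a, a ≠ x ∧ T₁.node a = T₁.node x)
    (hz' : ¬ T₁'.IsLeaf (T₁'.node x) ∨ ∃ a, a ≠ x ∧ T₁'.node a = T₁'.node x) :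
    TreeIso (DottedTree.compR2 T₁ x T₂ hr hz) (DottedTree.compR2 T₁' x T₂' hr' hz') where
  e := Equiv.sumCongr f.e g.e
  parent_comm := by
    rintro (v | w)
    · change (T₁'.parent (f.e v)).map Sum.inl =
        ((T₁.parent v).map Sum.inl).map (Equiv.sumCongr f.e g.e)
      simp [f.parent_comm, Function.comp_def]
    · change some ((T₂'.parent (g.e w)).elim (Sum.inl (T₁'.node x)) Sum.inr) =
        some (Equiv.sumCongr f.e g.e ((T₂.parent w).elim (Sum.inl (T₁.node x)) Sum.inr))
      cases h : T₂.parent w <;> simp [g.parent_comm, f.node_comm, h]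
  node_comm := by
    rintro (a | j)
    · exact congrArg Sum.inl (f.node_comm a.1)
    · exact congrArg Sum.inr (g.node_comm j)
  red_comm := by
    rintro (v | w)
    · exact f.red_comm v
    · exact g.red_comm w
  dotted_comm := by
    rintro (v | w)
    · exact f.dotted_comm v
    · exact g.dotted_comm w

def compR3 (f : TreeIso T₁ T₁') (g : TreeIso T₂ T₂') (x : I) (hr : T₂.red T₂.root)
    (hr' : T₂'.red T₂'.root) (hl : T₁.IsLeaf (T₁.node x)) (hl' : T₁'.IsLeaf (T₁'.node x))
    (hx : ∀ a, T₁.node a = T₁.node x → a = x) (hx' : ∀ a, T₁'.node a = T₁'.node x → a = x)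
    (z : {v : T₁.V // v ≠ T₁.node x}) (z' : {v : T₁'.V // v ≠ T₁'.node x})
    (hz : T₁.parent (T₁.node x) = some z.1) (hz' : T₁'.parent (T₁'.node x) = some z'.1) :
    TreeIso (DottedTree.compR3 T₁ x T₂ hr hl hx z hz)
      (DottedTree.compR3 T₁' x T₂' hr' hl' hx' z' hz') where
  e := Equiv.sumCongr (f.neNode x) g.neRoot
  parent_comm := by
    have hzz : z' = f.neNode x z := by
      have h : T₁'.parent (T₁'.node x) = some (f.e z.1) := by
        rw [f.node_comm, f.parent_comm, hz]; rfl
      exact Subtype.ext (Option.some_injective _ (hz'.symm.trans h))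
    rintro (v | w)
    · change (T₁'.parent (f.e v.1)).map (fun p => Sum.inl (avoid T₁' (T₁'.node x) z' p)) =
        ((T₁.parent v.1).map fun p => Sum.inl (avoid T₁ (T₁.node x) z p)).map
          (Equiv.sumCongr (f.neNode x) g.neRoot)
      cases hv : T₁.parent v.1 with
      | none => simp [f.parent_comm, hv]
      | some p =>
        have hp : p ≠ T₁.node x := by rintro rfl; exact hl _ hv
        have hp' : f.e p ≠ T₁'.node x := by rw [f.node_comm]; simpa using hp
        have h1 : avoid T₁ (T₁.node x) z p = ⟨p, hp⟩ := (avoid_eq hp).2 rfl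
        have h2 : avoid T₁' (T₁'.node x) z' (f.e p) = ⟨f.e p, hp'⟩ := (avoid_eq hp').2 rfl
        simp [f.parent_comm, hv, h1, h2, neNode]
    · change (T₂'.parent (g.e w.1)).map (place z' T₂') =
        ((T₂.parent w.1).map (place z T₂)).map (Equiv.sumCongr (f.neNode x) g.neRoot)
      rw [g.parent_comm, Option.map_map, Option.map_map, hzz]
      congr 1
      funext p
      exact g.place_comm (f.neNode x) z p
  node_comm := by
    rintro (a | j)
    · exact congrArg Sum.inl (Subtype.ext (f.node_comm a.1))
    · exact congrArg Sum.inr (Subtype.ext (g.node_comm j))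
  red_comm := by
    rintro (v | w)
    · exact f.red_comm v.1
    · exact g.red_comm w.1
  dotted_comm := by
    rintro (v | w)
    · exact f.dotted_comm v.1
    · refine or_congr (g.dotted_comm w.1) (and_congr ?_ ?_)
      · change T₂'.parent (g.e w.1) = some T₂'.root ↔ _
        rw [g.root_comm]
        exact g.parent_some _ _
      · rw [f.node_comm]
        exact f.dotted_comm _

end TreeIso

theorem comp_congr (x : I) {T₁ T₁' : DottedTree I} {T₂ T₂' : DottedTree J} (h₁ : T₁ ≈ T₁')
    (h₂ : T₂ ≈ T₂') : comp x T₁ T₂ ≈ comp x T₁' T₂' := by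
  obtain ⟨f⟩ := h₁
  obtain ⟨g⟩ := h₂
  have hr : T₂'.red T₂'.root ↔ T₂.red T₂.root := by rw [g.root_comm, g.red_comm]
  have h1 := f.isSingle_comm x
  have h2 : (¬ T₁'.IsLeaf (T₁'.node x) ∨ ∃ a, a ≠ x ∧ T₁'.node a = T₁'.node x) ↔
      (¬ T₁.IsLeaf (T₁.node x) ∨ ∃ a, a ≠ x ∧ T₁.node a = T₁.node x) := by
    simp [f.node_comm, f.isLeaf_comm]
  unfold comp
  by_cases c1 : T₂.red T₂.root
  · rw [dif_pos c1, dif_pos (hr.2 c1)]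
    by_cases c2 : T₁.IsSingle x
    · rw [dif_pos c2, dif_pos (h1.2 c2)]
      exact ⟨g.compR1 x _⟩
    · rw [dif_neg c2, dif_neg (mt h1.1 c2)]
      by_cases c3 : ¬ T₁.IsLeaf (T₁.node x) ∨ ∃ a, a ≠ x ∧ T₁.node a = T₁.node x
      · rw [dif_pos c3, dif_pos (h2.2 c3)]
        exact ⟨f.compR2 g x _ _ _ _⟩
      · rw [dif_neg c3, dif_neg (mt h2.1 c3)]
        exact ⟨f.compR3 g x _ _ _ _ _ _ _ _ _ _⟩
  · rw [dif_neg c1, dif_neg (mt hr.1 c1)]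
    exact ⟨f.compW g x _ _⟩

theorem relabel_congr (e : I ≃ J) {T T' : DottedTree I} (h : T ≈ T') :
    relabel e T ≈ relabel e T' := by
  obtain ⟨f⟩ := h
  exact ⟨⟨f.e, f.parent_comm, fun j => f.node_comm _, f.red_comm, f.dotted_comm⟩⟩

end DottedTree

/-- The symmetric operad of (arbitrarily labelled) dotted red and white trees. Its elements are
the isomorphism classes of labelled trees, so that the nodes have no identity of their own. -/
noncomputable def dottedTreeOperad : SymOperadData.{1} where
  obj I _ _ := Quotient (DottedTree.setoid I)
  map f := Quotient.map (DottedTree.relabel f) fun _ _ h => DottedTree.relabel_congr f h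
  one := Quotient.mk _ DottedTree.single
  comp x := Quotient.map₂ (DottedTree.comp x) fun _ _ h _ _ h' => DottedTree.comp_congr x h h'

/-! A tree `T` labelled by `I` is sent to an element of `MFF(I)`. For a node `v`, let `S_v` be the
set of labels at `v` and below it. The fraction is the product over the nodes of `[S_v]` for red `v`
and `1/[S_v]` for white `v`, divided once more by `[I]` when the root is red. The exponent of `u_i`
is the number of dotted edges between the node of `i` and the root. This map `toMFF` turns out to be
an injective morphism whose image is `FF₆^Σ`.

Morphism (`toMFF_comp`): in each rule the factors that `[J] F(x := J) F'` contributes at `[J]` match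
the nodes with this symbol that survive. Rules (W), (R2), (R3) are treated together by `Grafting`,
which records how the nodes, parents and dots of a composite come from the two trees; (R1) is
separate.

Injectivity (`equiv_of_toMFF_eq`): a node without labels has two children, so distinct nodes have
distinct sets `S_v` and nothing cancels in the product of the factors. The fraction gives the sets
`S_v` and the colours, and inclusion of these sets gives the tree. From any node one can descend to
a label along undotted edges (`exists_dots_eq`), because a white node without labels has a red
child. Hence the number of dots above `v` is the minimum of the exponents over `S_v`, and the dots
are determined.

Image: the six generators come from trees with two labels, so the generated sub-operad lies in the
image. Conversely (`subtreeGenerated`) each tree is built from its leaves upwards. The generator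
`1/[12]` gathers the labels of a node and attaches red children, `1/([2][12])` and `u₂/([2][12])`
attach white children by undotted and dotted edges, and `1/([1][2])` gathers the children of a red
node.

The operad axioms are checked on monomials and fractions only; trees inherit them through the
injective morphism. -/

namespace SymOperadData

/-! ### Transfer of the operad axioms: sub-operads and products. -/

/-- The axioms of a symmetric operad pass to any data which embed compatibly in an operad. -/
theorem IsSymmetricOperad.of_injective {P : SymOperadData.{u}} {Q : SymOperadData.{v}}
    (hP : P.IsSymmetricOperad)
    (φ : (I : Type) → [Finite I] → [Nonempty I] → Q.obj I → P.obj I)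
    (inj : ∀ (I : Type) [Finite I] [Nonempty I], Function.Injective (φ I))
    (map : ∀ {I J : Type} [Finite I] [Nonempty I] [Finite J] [Nonempty J] (f : I ≃ J)
      (A : Q.obj I), φ J (Q.map f A) = P.map f (φ I A))
    (one : φ Unit Q.one = P.one)
    (comp : ∀ {I J : Type} [Finite I] [Nonempty I] [Finite J] [Nonempty J] (x : I)
      (A : Q.obj I) (B : Q.obj J), φ (Ins x J) (Q.comp x A B) = P.comp x (φ I A) (φ J B)) :
    Q.IsSymmetricOperad where
  map_refl A := inj _ (by rw [map, hP.map_refl])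
  map_trans f g A := inj _ (by rw [map, map, map, hP.map_trans])
  comp_natural f g x A B := inj _ (by rw [comp, map, map, map, comp, hP.comp_natural])
  one_comp B := inj _ (by rw [map, comp, one, hP.one_comp])
  comp_one x A := inj _ (by rw [map, comp, one, hP.comp_one])
  comp_seq x y A B C := inj _ (by simp only [map, comp, hP.comp_seq])
  comp_par x y hyx hxy A B C := inj _ (by simp only [map, comp, hP.comp_par])

theorem IsSymmetricOperad.generate {P : SymOperadData.{u}} (hP : P.IsSymmetricOperad)
    (G : Set (P.obj (Fin 2))) : (P.generate G).IsSymmetricOperad :=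
  hP.of_injective (fun _ _ _ A => A.1) (fun _ _ _ => Subtype.val_injective)
    (fun _ _ => rfl) rfl (fun _ _ _ => rfl)

theorem IsSymmetricOperad.hadamard {P Q : SymOperadData.{u}} (hP : P.IsSymmetricOperad)
    (hQ : Q.IsSymmetricOperad) : (P.hadamard Q).IsSymmetricOperad where
  map_refl _ := Prod.ext (hP.map_refl _) (hQ.map_refl _)
  map_trans _ _ _ := Prod.ext (hP.map_trans _ _ _) (hQ.map_trans _ _ _)
  comp_natural _ _ _ _ _ := Prod.ext (hP.comp_natural _ _ _ _ _) (hQ.comp_natural _ _ _ _ _)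
  one_comp _ := Prod.ext (hP.one_comp _) (hQ.one_comp _)
  comp_one _ _ := Prod.ext (hP.comp_one _ _) (hQ.comp_one _ _)
  comp_seq _ _ _ _ _ := Prod.ext (hP.comp_seq _ _ _ _ _) (hQ.comp_seq _ _ _ _ _)
  comp_par _ _ _ _ _ _ _ :=
    Prod.ext (hP.comp_par _ _ _ _ _ _ _) (hQ.comp_par _ _ _ _ _ _ _)

end SymOperadData

/-! ### The operad of monomials. -/

theorem monOperad_isSymmetricOperad : monOperad.IsSymmetricOperad where
  map_refl _ := rfl
  map_trans _ _ _ := rfl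
  comp_natural f g x A B := by
    funext t
    obtain ⟨t, rfl⟩ := (Ins.congr f g x).surjective t
    change A (f.symm (Ins.collapse (f x) _ (Ins.congr f g x t))) + _ =
      A (Ins.collapse x _ ((Ins.congr f g x).symm (Ins.congr f g x t))) +
        Sum.elim (fun _ => 0) B ((Ins.congr f g x).symm (Ins.congr f g x t))
    rw [Equiv.symm_apply_apply]
    rcases t with t | t
    · change A (f.symm (f t.1)) + 0 = A t.1 + 0
      rw [f.symm_apply_apply]
    · change A (f.symm (f x)) + B (g.symm (g t)) = A x + B t
      rw [f.symm_apply_apply, g.symm_apply_apply]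
  one_comp B := by
    funext t
    change 0 + B t = B t
    exact zero_add _
  comp_one x A := by
    funext t
    change A (Ins.collapse x Unit ((Ins.unitRight x).symm t)) +
      Sum.elim (fun _ => 0) (fun _ => 0) ((Ins.unitRight x).symm t) = A t
    obtain ⟨t, rfl⟩ := (Ins.unitRight x).surjective t
    rw [Equiv.symm_apply_apply]
    rcases t with t | t <;> simp [Ins.unitRight, Ins.collapse]
  comp_seq x y A B C := by
    funext t
    rcases t with a | b | c
    · change A a + 0 + 0 = A a + 0
      rfl
    · change A x + B b + 0 = A x + (B b + 0)
      rfl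
    · change A x + B y + C c = A x + (B y + C c)
      exact add_assoc _ _ _
  comp_par x y hyx hxy A B C := by
    funext t
    rcases t with ⟨a | c, h⟩ | b
    · rfl
    · change A y + 0 + C c = A y + C c + 0
      exact add_right_comm _ _ _
    · change A x + B b + 0 = A x + 0 + B b
      exact add_right_comm _ _ _

/-! ### The operad of formal fractions. -/

namespace FSymbol

theorem image_id {I : Type} : (image id : FSymbol I → FSymbol I) = id :=
  funext fun S => Subtype.ext (Set.image_id S.1)

theorem image_comp {I J K : Type} (f : I → J) (g : J → K) :
    image (g ∘ f) = image g ∘ image f :=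
  funext fun S => Subtype.ext (Set.image_comp g f S.1)

theorem mem_image_equiv {I J : Type} (f : I ≃ J) (S : FSymbol I) (i : I) :
    f i ∈ (image f S).1 ↔ i ∈ S.1 := f.injective.mem_set_image

theorem mem_subst {I : Type} (x : I) {J : Type} [Nonempty J] (S : FSymbol I) (t : Ins x J) :
    t ∈ (subst x J S).1 ↔ Ins.collapse x J t ∈ S.1 := Iff.rfl

/-- Symbols agree if they agree after transport along a bijection. -/
theorem ext_equiv {I J : Type} (f : I ≃ J) {S T : FSymbol J}
    (h : ∀ i, f i ∈ S.1 ↔ f i ∈ T.1) : S = T :=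
  Subtype.ext (Set.ext fun j => by simpa using h (f.symm j))

end FSymbol

/-- The composition `F ∘ₓ G` of formal fractions. -/
noncomputable def ffComp {I J : Type} [Nonempty J] (x : I) (F : FSymbol I →₀ ℤ)
    (G : FSymbol J →₀ ℤ) : FSymbol (Ins x J) →₀ ℤ :=
  Finsupp.single (FSymbol.image Sum.inr (FSymbol.full J)) 1
    + F.mapDomain (FSymbol.subst x J) + G.mapDomain (FSymbol.image Sum.inr)

section

open Finsupp

/-- Once relabellings are pushed inside the three terms, each operad axiom reduces to identities
between maps on symbols. -/
theorem mapDomain_ffComp {I J K : Type} [Nonempty J] (x : I) (F : FSymbol I →₀ ℤ)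
    (G : FSymbol J →₀ ℤ) (h : Ins x J → K) :
    (ffComp x F G).mapDomain (FSymbol.image h) =
      single (FSymbol.image (h ∘ Sum.inr) (FSymbol.full J)) 1
        + F.mapDomain (FSymbol.image h ∘ FSymbol.subst x J)
        + G.mapDomain (FSymbol.image (h ∘ Sum.inr)) := by
  simp only [ffComp, mapDomain_add, mapDomain_single, ← mapDomain_comp, FSymbol.image_comp]
  rfl

theorem ffComp_natural {I I' J J' : Type} [Nonempty J] [Nonempty J'] (f : I ≃ I') (g : J ≃ J')
    (x : I) (F : FSymbol I →₀ ℤ) (G : FSymbol J →₀ ℤ) :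
    ffComp (f x) (F.mapDomain (FSymbol.image f)) (G.mapDomain (FSymbol.image g)) =
      (ffComp x F G).mapDomain (FSymbol.image (Ins.congr f g x)) := by
  rw [mapDomain_ffComp, ffComp, ← mapDomain_comp, ← mapDomain_comp]
  congr 1
  · congr 1
    · congr 1
      refine FSymbol.ext_equiv (Ins.congr f g x) ?_
      rintro (t | t) <;> simp [FSymbol.image, FSymbol.full, Ins.congr]
    · congr 1
      funext S
      refine FSymbol.ext_equiv (Ins.congr f g x) fun t => ?_
      simp only [Function.comp, FSymbol.mem_subst, FSymbol.mem_image_equiv]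
      rw [← FSymbol.mem_image_equiv f]
      rcases t with t | t <;> rfl
  · congr 1
    rw [← FSymbol.image_comp]
    rfl

/-- The factor `1/[∗]` becomes `1/[J]` under substitution and cancels the `[J]` brought by the
composition. -/
theorem one_ffComp {J : Type} [Nonempty J] (G : FSymbol J →₀ ℤ) :
    (ffComp () (-single (FSymbol.full Unit) 1) G).mapDomain (FSymbol.image (Ins.unitLeft J)) =
      G := by
  have h1 : (Ins.unitLeft J : Ins () J → J) ∘ Sum.inr = id := rfl
  have h2 : FSymbol.image (Ins.unitLeft J) (FSymbol.subst () J (FSymbol.full Unit)) =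
      FSymbol.full J := by
    refine FSymbol.ext_equiv (Ins.unitLeft J) fun t => ?_
    rw [FSymbol.mem_image_equiv]
    simp [FSymbol.subst, FSymbol.full]
  rw [mapDomain_ffComp, h1, FSymbol.image_id, mapDomain_id, ← single_neg, mapDomain_single,
    Function.comp_apply, h2]
  simp

theorem ffComp_one {I : Type} (x : I) (F : FSymbol I →₀ ℤ) :
    (ffComp x F (-single (FSymbol.full Unit) 1)).mapDomain (FSymbol.image (Ins.unitRight x)) =
      F := by
  have h2 : FSymbol.image (Ins.unitRight x) ∘ FSymbol.subst x Unit = id := by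
    funext S
    refine FSymbol.ext_equiv (Ins.unitRight x) fun t => ?_
    rw [Function.comp_apply, FSymbol.mem_image_equiv, FSymbol.mem_subst]
    rcases t with t | t <;> rfl
  rw [mapDomain_ffComp, h2, mapDomain_id, ← single_neg, mapDomain_single]
  simp

theorem ffComp_seq {I J K : Type} [Nonempty J] [Nonempty K] (x : I) (y : J)
    (F : FSymbol I →₀ ℤ) (G : FSymbol J →₀ ℤ) (H : FSymbol K →₀ ℤ) :
    (ffComp (Sum.inr y : Ins x J) (ffComp x F G) H).mapDomain (FSymbol.image (Ins.seq x y K)) =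
      ffComp x F (ffComp y G H) := by
  -- The factor `[J]` of the inner composition contains `y`. Substitution turns it into the full
  -- symbol of `(J ∖ {y}) ⊔ K`, the factor brought by the outer composition on the right-hand side.
  have h1 : FSymbol.image (Ins.seq x y K) ((FSymbol.subst (Sum.inr y : Ins x J) K)
      (FSymbol.image Sum.inr (FSymbol.full J))) =
      FSymbol.image Sum.inr (FSymbol.full (Ins y K)) := by
    refine FSymbol.ext_equiv (Ins.seq x y K) fun t => ?_
    rw [FSymbol.mem_image_equiv, FSymbol.mem_subst]
    rcases t with ⟨t | t, h⟩ | t <;>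
      simp [FSymbol.image, FSymbol.full, Ins.seq, Ins.collapse]
  have h2 : FSymbol.image (Ins.seq x y K) ∘ FSymbol.subst (Sum.inr y : Ins x J) K ∘
      FSymbol.subst x J = FSymbol.subst x (Ins y K) := by
    funext S
    refine FSymbol.ext_equiv (Ins.seq x y K) fun t => ?_
    simp only [Function.comp, FSymbol.mem_subst, FSymbol.mem_image_equiv]
    rcases t with ⟨t | t, h⟩ | t <;> rfl
  have h3 : FSymbol.image (Ins.seq x y K) ∘ FSymbol.subst (Sum.inr y : Ins x J) K ∘
      FSymbol.image Sum.inr = FSymbol.image (Sum.inr : _ → Ins x (Ins y K)) ∘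
        FSymbol.subst y K := by
    funext S
    refine FSymbol.ext_equiv (Ins.seq x y K) fun t => ?_
    simp only [Function.comp, FSymbol.mem_subst, FSymbol.mem_image_equiv]
    rcases t with ⟨t | t, h⟩ | t <;>
      simp [FSymbol.image, FSymbol.subst, Ins.seq, Ins.collapse]
  rw [mapDomain_ffComp]
  simp only [ffComp, mapDomain_add, mapDomain_single, ← mapDomain_comp, Function.comp_assoc,
    Function.comp_apply, h1, h2, h3, ← FSymbol.image_comp]
  have h4 : (Ins.seq x y K : _ → Ins x (Ins y K)) ∘ Sum.inr = Sum.inr ∘ Sum.inr := rfl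
  have h5 : FSymbol.image (Sum.inr : _ → Ins x (Ins y K)) (FSymbol.image Sum.inr
      (FSymbol.full K)) = FSymbol.image (Sum.inr ∘ Sum.inr) (FSymbol.full K) := by
    rw [FSymbol.image_comp]; rfl
  rw [h4, h5]
  abel

theorem ffComp_par {I J K : Type} [Nonempty J] [Nonempty K] (x y : I) (hyx : y ≠ x)
    (hxy : x ≠ y) (F : FSymbol I →₀ ℤ) (G : FSymbol J →₀ ℤ) (H : FSymbol K →₀ ℤ) :
    (ffComp (Sum.inl ⟨y, hyx⟩ : Ins x J) (ffComp x F G) H).mapDomain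
        (FSymbol.image (Ins.par x y hyx hxy J K)) =
      ffComp (Sum.inl ⟨x, hxy⟩ : Ins y K) (ffComp y F H) G := by
  have h2 : FSymbol.image (Ins.par x y hyx hxy J K) ∘
      FSymbol.subst (Sum.inl ⟨y, hyx⟩ : Ins x J) K ∘ FSymbol.subst x J =
      FSymbol.subst (Sum.inl ⟨x, hxy⟩ : Ins y K) J ∘ FSymbol.subst y K := by
    funext S
    refine FSymbol.ext_equiv (Ins.par x y hyx hxy J K) fun t => ?_
    simp only [Function.comp, FSymbol.mem_subst, FSymbol.mem_image_equiv]
    rcases t with ⟨t | t, h⟩ | t <;> rfl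
  -- The label `y` does not lie in the block `J`, so symbols inside `J` are untouched by the
  -- substitution at `y`; `h4` is the same fact with the two blocks exchanged.
  have h3 : FSymbol.image (Ins.par x y hyx hxy J K) ∘
      FSymbol.subst (Sum.inl ⟨y, hyx⟩ : Ins x J) K ∘ FSymbol.image Sum.inr =
      FSymbol.image Sum.inr := by
    funext S
    refine FSymbol.ext_equiv (Ins.par x y hyx hxy J K) fun t => ?_
    simp only [Function.comp, FSymbol.mem_subst, FSymbol.mem_image_equiv]
    rcases t with ⟨t | t, h⟩ | t <;>
      simp [FSymbol.image, Ins.par, Ins.collapse]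
  have h4 : FSymbol.subst (Sum.inl ⟨x, hxy⟩ : Ins y K) J ∘ FSymbol.image Sum.inr =
      FSymbol.image (Ins.par x y hyx hxy J K ∘ Sum.inr) := by
    rw [FSymbol.image_comp]
    funext S
    refine FSymbol.ext_equiv (Ins.par x y hyx hxy J K) fun t => ?_
    simp only [Function.comp, FSymbol.mem_subst, FSymbol.mem_image_equiv]
    rcases t with ⟨t | t, h⟩ | t <;>
      simp [FSymbol.image, Ins.par, Ins.collapse]
  have h3' := congrFun h3 (FSymbol.full J)
  have h4' := congrFun h4 (FSymbol.full K)
  rw [mapDomain_ffComp]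
  simp only [Function.comp_apply] at h3' h4'
  simp only [ffComp, mapDomain_add, mapDomain_single, ← mapDomain_comp, Function.comp_assoc,
    Function.comp_apply, h2, h3, h4, h3', h4']
  abel

end

theorem ffOperad_isSymmetricOperad : ffOperad.IsSymmetricOperad where
  map_refl {I} _ _ A := by
    have h (F : FSymbol I →₀ ℤ) : F.mapDomain (FSymbol.image id) = F := by
      rw [FSymbol.image_id, Finsupp.mapDomain_id]
    exact h A
  map_trans {I J K} _ _ _ _ _ _ f g A := by
    have h (F : FSymbol I →₀ ℤ) : F.mapDomain (FSymbol.image (g ∘ f)) =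
        (F.mapDomain (FSymbol.image f)).mapDomain (FSymbol.image g) := by
      rw [FSymbol.image_comp, Finsupp.mapDomain_comp]
    exact h A
  comp_natural f g x A B := ffComp_natural f g x A B
  one_comp B := one_ffComp B
  comp_one x A := ffComp_one x A
  comp_seq x y A B C := ffComp_seq x y A B C
  comp_par x y hyx hxy A B C := ffComp_par x y hyx hxy A B C

theorem mffOperad_isSymmetricOperad : mffOperad.IsSymmetricOperad :=
  monOperad_isSymmetricOperad.hadamard ffOperad_isSymmetricOperad

/-! ### Ancestors, descendant labels and dots in a tree. -/

namespace DottedTree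

variable {I : Type}

noncomputable instance (T : DottedTree I) : Fintype T.V :=
  @Fintype.ofFinite _ T.finite

/-- `T.Anc w v` says that `v` is an ancestor of `w`, or `w` itself. -/
def Anc (T : DottedTree I) : T.V → T.V → Prop :=
  Relation.ReflTransGen fun w p => T.parent w = some p

namespace Anc

variable {T : DottedTree I} {u v w p : T.V}

theorem refl (v : T.V) : T.Anc v v := Relation.ReflTransGen.refl

theorem trans (h : T.Anc u v) (h' : T.Anc v w) : T.Anc u w := Relation.ReflTransGen.trans h h'

theorem of_parent (h : T.parent w = some p) : T.Anc w p := Relation.ReflTransGen.single h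

end Anc

theorem anc_iff (T : DottedTree I) {w v : T.V} :
    T.Anc w v ↔ w = v ∨ ∃ p, T.parent w = some p ∧ T.Anc p v :=
  Relation.ReflTransGen.cases_head_iff

theorem anc_iff_child (T : DottedTree I) {w v : T.V} :
    T.Anc w v ↔ w = v ∨ ∃ c, T.parent c = some v ∧ T.Anc w c := by
  refine Relation.ReflTransGen.cases_tail_iff _ _ _ |>.trans ?_
  refine or_congr eq_comm ⟨?_, ?_⟩ <;> rintro ⟨c, h, h'⟩ <;> exact ⟨c, h', h⟩

theorem anc_iff_of_parent (T : DottedTree I) {w p v : T.V} (h : T.parent w = some p) :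
    T.Anc w v ↔ w = v ∨ T.Anc p v := by
  rw [T.anc_iff]
  simp [h]

theorem anc_root (T : DottedTree I) (w : T.V) : T.Anc w T.root := by
  induction w using T.wf.induction with
  | _ w ih =>
    by_cases h : w = T.root
    · exact h ▸ Anc.refl _
    · obtain ⟨p, hp⟩ := T.exists_parent h
      exact (Anc.of_parent hp).trans (ih p hp)

theorem anc_root_iff (T : DottedTree I) {v : T.V} : T.Anc T.root v ↔ T.root = v := by
  rw [T.anc_iff]
  simp [T.parent_root]

theorem not_anc_of_parent (T : DottedTree I) {c p : T.V} (h : T.parent c = some p) :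
    ¬ T.Anc p c := by
  intro h'
  refine T.wf.transGen.irrefl.irrefl c ?_
  have h2 : Relation.TransGen (fun w p => T.parent w = some p) c c :=
    Relation.TransGen.head' h h'
  exact Relation.transGen_swap.1 h2

theorem Anc.antisymm {T : DottedTree I} {v w : T.V} (h : T.Anc w v) (h' : T.Anc v w) :
    w = v := by
  rcases T.anc_iff.1 h with h | ⟨p, hp, hpv⟩
  · exact h
  · exact absurd (hpv.trans h') (T.not_anc_of_parent hp)

theorem Anc.total {T : DottedTree I} {u v w : T.V} (h : T.Anc u v) (h' : T.Anc u w) :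
    T.Anc v w ∨ T.Anc w v := by
  refine Relation.ReflTransGen.total_of_right_unique ?_ h h'
  intro a b c hb hc
  exact Option.some_injective _ (hb.symm.trans hc)

/-- Distinct children of a node have no common descendants. -/
theorem eq_of_anc_of_parent (T : DottedTree I) {w c c' p : T.V} (hc : T.parent c = some p)
    (hc' : T.parent c' = some p) (h : T.Anc w c) (h' : T.Anc w c') : c = c' := by
  wlog hcc : T.Anc c c' generalizing c c'
  · exact (this hc' hc h' h ((h.total h').resolve_left hcc)).symm
  rcases (T.anc_iff_of_parent hc).1 hcc with h1 | h1
  · exact h1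
  · exact absurd h1 (T.not_anc_of_parent hc')

/-- Induction from the leaves of a tree to its root. -/
theorem induction_children (T : DottedTree I) {P : T.V → Prop}
    (h : ∀ v, (∀ c, T.parent c = some v → P c) → P v) (v : T.V) : P v := by
  have := T.finite
  have hi : Std.Irrefl (Relation.TransGen fun p c => T.parent c = some p) :=
    T.wf.transGen.irrefl
  have hwf : WellFounded (fun c p => Relation.TransGen (fun p c => T.parent c = some p) p c) :=
    @Finite.wellFounded_of_trans_of_irrefl _ _ _ ⟨fun _ _ _ a b => b.trans a⟩
      ⟨fun a => hi.irrefl a⟩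
  induction v using hwf.induction with
  | _ v ih => exact h v fun c hc => ih c (.single hc)

/-- The labels of the descendants of a node. -/
def desc (T : DottedTree I) (v : T.V) : Set I := {i | T.Anc (T.node i) v}

theorem mem_desc (T : DottedTree I) {i : I} {v : T.V} : i ∈ T.desc v ↔ T.Anc (T.node i) v :=
  Iff.rfl

open Classical in
/-- The number of dotted edges above a node. -/
noncomputable def dots (T : DottedTree I) (v : T.V) : ℕ :=
  ∑ w, if T.Anc v w ∧ T.dotted w then 1 else 0

theorem not_dotted_root (T : DottedTree I) : ¬ T.dotted T.root := fun h => by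
  obtain ⟨p, hp, -⟩ := T.dotted_white _ h
  simp [T.parent_root] at hp

theorem dots_root (T : DottedTree I) : T.dots T.root = 0 := by
  refine Finset.sum_eq_zero fun w _ => if_neg ?_
  rintro ⟨h, hd⟩
  rw [anc_root_iff] at h
  exact T.not_dotted_root (h ▸ hd)

open Classical in
theorem dots_of_parent (T : DottedTree I) {c p : T.V} (h : T.parent c = some p) :
    T.dots c = T.dots p + if T.dotted c then 1 else 0 := by
  have h1 : (if T.dotted c then 1 else 0) =
      ∑ w, if w = c then (if T.dotted w then 1 else 0) else 0 := by simp
  rw [dots, dots, h1, ← Finset.sum_add_distrib]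
  refine Finset.sum_congr rfl fun w _ => ?_
  rw [T.anc_iff_of_parent h]
  by_cases hw : w = c
  · subst hw
    simp [T.not_anc_of_parent h]
  · simp [hw, Ne.symm hw]

theorem dots_le_of_anc (T : DottedTree I) {w v : T.V} (h : T.Anc w v) :
    T.dots v ≤ T.dots w := by
  induction w using T.wf.induction with
  | _ w ih =>
    rcases T.anc_iff.1 h with rfl | ⟨p, hp, hpv⟩
    · exact le_rfl
    · rw [T.dots_of_parent hp]
      exact (ih p hp hpv).trans (Nat.le_add_right _ _)

theorem not_dotted_of_parent_red (T : DottedTree I) {c p : T.V} (h : T.parent c = some p)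
    (hp : T.red p) : ¬ T.dotted c := fun hd => by
  obtain ⟨q, hq, hq', -⟩ := T.dotted_white _ hd
  rw [h] at hq
  exact hq' (Option.some_injective _ hq ▸ hp)

theorem not_dotted_of_red (T : DottedTree I) {c : T.V} (hc : T.red c) : ¬ T.dotted c :=
  fun hd => by
    obtain ⟨q, -, -, h⟩ := T.dotted_white _ hd
    exact h hc

/-- From each node one descends to a label without passing a dot. -/
theorem exists_dots_eq (T : DottedTree I) (v : T.V) :
    ∃ i ∈ T.desc v, T.dots (T.node i) = T.dots v := by
  induction v using T.induction_children with
  | h v ih =>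
    by_cases hv : ∃ i, T.node i = v
    · obtain ⟨i, rfl⟩ := hv
      exact ⟨i, Anc.refl _, rfl⟩
    · push Not at hv
      -- Edges touching a red node carry no dot. A red `v` can therefore be left by any edge, and a
      -- white `v` without labels has a red child.
      obtain ⟨c, hc, hd⟩ : ∃ c, T.parent c = some v ∧ ¬ T.dotted c := by
        by_cases hr : T.red v
        · obtain ⟨a, -, -, ha, -⟩ := T.two_children v hv
          exact ⟨a, ha, T.not_dotted_of_parent_red ha hr⟩
        · rw [T.red_iff] at hr
          push Not at hr
          obtain ⟨c, hc, hcr⟩ := hr hv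
          exact ⟨c, hc, T.not_dotted_of_red hcr⟩
      obtain ⟨i, hi, hiv⟩ := ih c hc
      refine ⟨i, Anc.trans hi (.of_parent hc), ?_⟩
      rw [hiv, T.dots_of_parent hc, if_neg hd, add_zero]

theorem desc_nonempty (T : DottedTree I) (v : T.V) : (T.desc v).Nonempty :=
  let ⟨i, hi, _⟩ := T.exists_dots_eq v
  ⟨i, hi⟩

theorem desc_root (T : DottedTree I) : T.desc T.root = Set.univ :=
  Set.eq_univ_of_forall fun _ => T.anc_root _

theorem desc_of_isLeaf (T : DottedTree I) {v : T.V} (h : T.IsLeaf v) :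
    T.desc v = {i | T.node i = v} :=
  Set.ext fun _ => T.anc_iff_child.trans (or_iff_left fun ⟨c, hc, _⟩ => h c hc)

/-- A common label makes `v` and `w` comparable. If `v` were strictly below `w`, all labels below
`w` would lie under a single child of `w`; this is impossible, as `w` either carries a label or has
two children with nonempty disjoint sets of labels. -/
theorem desc_subset_iff (T : DottedTree I) {v w : T.V} : T.desc w ⊆ T.desc v ↔ T.Anc w v := by
  refine ⟨fun h => ?_, fun h i hi => Anc.trans hi h⟩
  obtain ⟨i, hi⟩ := T.desc_nonempty w
  rcases Anc.total hi (h hi) with h1 | h1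
  · exact h1
  rcases T.anc_iff_child.1 h1 with rfl | ⟨c, hc, hvc⟩
  · exact Anc.refl _
  exfalso
  have hwc : ∀ j ∈ T.desc w, T.Anc (T.node j) c := fun j hj => Anc.trans (h hj) hvc
  by_cases hw : ∃ j, T.node j = w
  · obtain ⟨j, rfl⟩ := hw
    exact T.not_anc_of_parent hc (hwc j (Anc.refl _))
  · push Not at hw
    obtain ⟨a, b, hab, ha, hb⟩ := T.two_children w hw
    have key : ∀ a, T.parent a = some w → a = c := fun a ha => by
      obtain ⟨j, hj⟩ := T.desc_nonempty a
      exact T.eq_of_anc_of_parent ha hc hj (hwc j (Anc.trans hj (.of_parent ha)))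
    exact hab ((key a ha).trans (key b hb).symm)

theorem desc_injective (T : DottedTree I) : Function.Injective T.desc := fun _ _ h =>
  Anc.antisymm (T.desc_subset_iff.1 h.le) (T.desc_subset_iff.1 h.ge)

/-- The symbol of the set of labels below a node. -/
def symbol (T : DottedTree I) (v : T.V) : FSymbol I := ⟨T.desc v, T.desc_nonempty v⟩

theorem symbol_injective (T : DottedTree I) : Function.Injective T.symbol := fun _ _ h =>
  T.desc_injective (congrArg Subtype.val h)

theorem symbol_root [Nonempty I] (T : DottedTree I) : T.symbol T.root = FSymbol.full I :=
  Subtype.ext T.desc_root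

/-! ### The fraction and the monomial of a tree. -/

open Classical in
/-- The factor of a node in the fraction of a tree: `[S]` for a red node and `1/[S]` for a white
node, where `S` is the set of labels below the node. -/
noncomputable def factor (T : DottedTree I) (v : T.V) : FSymbol I →₀ ℤ :=
  Finsupp.single (T.symbol v) (if T.red v then 1 else -1)

theorem factor_of_red (T : DottedTree I) {v : T.V} (h : T.red v) :
    T.factor v = Finsupp.single (T.symbol v) 1 := by
  rw [factor, if_pos h]

theorem factor_of_not_red (T : DottedTree I) {v : T.V} (h : ¬ T.red v) :
    T.factor v = -Finsupp.single (T.symbol v) 1 := by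
  rw [factor, if_neg h, Finsupp.single_neg]

/-- The product of the factors of all nodes. -/
noncomputable def factors (T : DottedTree I) : FSymbol I →₀ ℤ := ∑ v, T.factor v

open Classical in
/-- The fraction of a tree. -/
noncomputable def fraction [Nonempty I] (T : DottedTree I) : FSymbol I →₀ ℤ :=
  T.factors - if T.red T.root then Finsupp.single (FSymbol.full I) 1 else 0

/-- The monomial of a tree. -/
noncomputable def monomial (T : DottedTree I) (i : I) : ℕ := T.dots (T.node i)

/-- The monomial and the fraction of a tree. -/
noncomputable def toMFF [Finite I] [Nonempty I] (T : DottedTree I) : mffOperad.obj I :=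
  (T.monomial, T.fraction)

end DottedTree

/-! ### Invariance under isomorphism and compatibility with relabelling and the unit. -/

theorem Fintype.sum_subtype_ne {α M : Type*} [Fintype α] [AddCommGroup M] (a : α)
    [Fintype {b // b ≠ a}] (f : α → M) : ∑ b : {b // b ≠ a}, f b.1 = ∑ b, f b - f a := by
  classical
  rw [← Finset.add_sum_erase _ f (Finset.mem_univ a), add_sub_cancel_left]
  exact (Finset.sum_subtype _ (by simp) f).symm

theorem FSymbol.inr_mem_image {L J : Type} (S : FSymbol J) (j : J) :
    (Sum.inr j : L ⊕ J) ∈ (FSymbol.image Sum.inr S).1 ↔ j ∈ S.1 :=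
  Sum.inr_injective.mem_set_image

namespace DottedTree

variable {I J : Type}

/-- The recursion through the parent has a unique solution, by well-foundedness. Ancestors in a
transported or composed tree are identified by checking this recursion only. -/
theorem anc_unique (T : DottedTree I) (R : T.V → T.V → Prop)
    (h : ∀ w v, R w v ↔ w = v ∨ ∃ p, T.parent w = some p ∧ R p v) (w v : T.V) :
    T.Anc w v ↔ R w v := by
  induction w using T.wf.induction with
  | _ w ih =>
    rw [h, T.anc_iff]
    exact or_congr_right (exists_congr fun p => and_congr_right fun hp => ih p hp)

open Classical in
-- The same principle for the number of dots, determined by its value at the root and its increment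
-- along each edge.
theorem dots_unique (T : DottedTree I) (d : T.V → ℕ) (h0 : d T.root = 0)
    (h : ∀ c p, T.parent c = some p → d c = d p + if T.dotted c then 1 else 0) (v : T.V) :
    T.dots v = d v := by
  induction v using T.wf.induction with
  | _ v ih =>
    by_cases hv : v = T.root
    · rw [hv, h0, dots_root]
    · obtain ⟨p, hp⟩ := T.exists_parent hv
      rw [T.dots_of_parent hp, h v p hp, ih p hp]

theorem factors_eq_sum (T : DottedTree I) {α : Type} [Fintype α] (e : α ≃ T.V) :
    T.factors = ∑ a, T.factor (e a) :=
  (Equiv.sum_comp e _).symm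

open Classical in
theorem factors_eq_mapDomain {T : DottedTree I} {T' : DottedTree J} (h : I → J)
    (e : T.V ≃ T'.V) (hs : ∀ v, T'.symbol (e v) = FSymbol.image h (T.symbol v))
    (hr : ∀ v, T'.red (e v) ↔ T.red v) :
    T'.factors = T.factors.mapDomain (FSymbol.image h) := by
  rw [T'.factors_eq_sum e, factors, Finsupp.mapDomain_finsetSum]
  simp only [factor, Finsupp.mapDomain_single, hs, hr]

namespace TreeIso

variable {T T' : DottedTree I}

theorem anc_comm (f : TreeIso T T') (w v : T.V) : T'.Anc (f.e w) (f.e v) ↔ T.Anc w v := by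
  refine (T.anc_unique (fun w v => T'.Anc (f.e w) (f.e v)) (fun w v => ?_) w v).symm
  rw [T'.anc_iff, f.e.injective.eq_iff, f.parent_comm]
  simp

theorem symbol_comm (f : TreeIso T T') (v : T.V) : T'.symbol (f.e v) = T.symbol v := by
  refine Subtype.ext (Set.ext fun i => ?_)
  change T'.Anc (T'.node i) (f.e v) ↔ T.Anc (T.node i) v
  rw [f.node_comm, f.anc_comm]

open Classical in
theorem dots_comm (f : TreeIso T T') (v : T.V) : T'.dots (f.e v) = T.dots v := by
  refine (T.dots_unique (fun v => T'.dots (f.e v)) ?_ (fun c p h => ?_) v).symm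
  · rw [← f.root_comm, dots_root]
  · rw [T'.dots_of_parent ((f.parent_some c p).2 h)]
    simp only [f.dotted_comm]

open Classical in
theorem toMFF_eq [Finite I] [Nonempty I] (f : TreeIso T T') : T.toMFF = T'.toMFF := by
  refine Prod.ext (funext fun i => ?_) ?_
  · change T.dots (T.node i) = T'.dots (T'.node i)
    rw [f.node_comm, f.dots_comm]
  · change T.fraction = T'.fraction
    unfold fraction
    congr 1
    · rw [T'.factors_eq_sum f.e]
      refine Finset.sum_congr rfl fun v _ => ?_
      simp only [factor, f.symbol_comm, f.red_comm]
    · simp only [f.root_comm, f.red_comm]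

end TreeIso

open Classical in
theorem toMFF_relabel [Finite I] [Nonempty I] [Finite J] [Nonempty J] (f : I ≃ J)
    (T : DottedTree I) : (relabel f T).toMFF = mffOperad.map f T.toMFF := by
  have hs : ∀ v, (relabel f T).symbol v = FSymbol.image f (T.symbol v) := fun v =>
    FSymbol.ext_equiv f fun i => by
      rw [FSymbol.mem_image_equiv]
      change T.Anc (T.node (f.symm (f i))) v ↔ _
      rw [f.symm_apply_apply]
      rfl
  refine Prod.ext rfl ?_
  change (relabel f T).fraction = T.fraction.mapDomain (FSymbol.image f)
  have h1 : (relabel f T).factors = T.factors.mapDomain (FSymbol.image f) := by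
    exact factors_eq_mapDomain f (Equiv.refl T.V) hs fun _ => Iff.rfl
  have h2 : FSymbol.image f (FSymbol.full I) = FSymbol.full J :=
    Subtype.ext (by simp [FSymbol.image, FSymbol.full])
  rw [fraction, fraction, h1, Finsupp.mapDomain_sub]
  congr 1
  have h3 : (relabel f T).red (relabel f T).root ↔ T.red T.root := Iff.rfl
  simp only [h3]
  split_ifs
  · rw [Finsupp.mapDomain_single, h2]
  · rw [Finsupp.mapDomain_zero]

theorem toMFF_single : single.toMFF = mffOperad.one := by
  refine Prod.ext (funext fun i => single.dots_root) ?_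
  change single.fraction = -Finsupp.single (FSymbol.full Unit) 1
  have h : ¬ single.red single.root := fun h => h
  have h1 : single.factors = single.factor single.root := by
    rw [single.factors_eq_sum (Equiv.refl Unit), Fintype.sum_unique]
    rfl
  rw [fraction, if_neg h, sub_zero, h1, ← Finsupp.single_neg, factor, if_neg h, symbol_root]

/-! ### Compatibility with the composition rules. -/

open Classical in
/-- A description of a tree labelled by `Ins x J` as obtained from nodes `M` of `T₁` and nodes
`N` of `T₂`, the latter being attached below the node `z` of `T₁`. -/
structure Grafting (T₁ : DottedTree I) (x : I) (T₂ : DottedTree J) (C : DottedTree (Ins x J))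
    (M N : Type) where
  f : M → T₁.V
  g : N → T₂.V
  e : M ⊕ N ≃ C.V
  z : M
  f_injective : Function.Injective f
  g_injective : Function.Injective g
  root : ∃ r, C.root = e (.inl r) ∧ f r = T₁.root
  parent_inl : ∀ v, (T₁.parent (f v) = none ∧ C.parent (e (.inl v)) = none) ∨
    ∃ q, T₁.parent (f v) = some (f q) ∧ C.parent (e (.inl v)) = some (e (.inl q))
  -- A node from `T₂` either keeps its parent or is a topmost one, attached to `z`. In the second
  -- case the numerical condition says that the dots above it in `C` are those above `x` in `T₁`
  -- plus those above it in `T₂`.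
  parent_inr : ∀ w,
    (∃ q, T₂.parent (g w) = some (g q) ∧ C.parent (e (.inr w)) = some (e (.inr q)) ∧
      (C.dotted (e (.inr w)) ↔ T₂.dotted (g w))) ∨
    (C.parent (e (.inr w)) = some (e (.inl z)) ∧ (∀ v, T₂.Anc (g w) (g v) → g w = g v) ∧
      T₁.dots (f z) + (if C.dotted (e (.inr w)) then 1 else 0) =
        T₁.dots (T₁.node x) + T₂.dots (g w))
  -- For (W) and (R2) the node `z` is the node of `x`. For (R3) it is the parent of that node, which
  -- is itself not kept in `M`.
  anc_z : ∀ v, T₁.Anc (T₁.node x) (f v) ↔ T₁.Anc (f z) (f v)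
  node_inl : ∀ a, ∃ m, C.node (.inl a) = e (.inl m) ∧ f m = T₁.node a.1
  -- The second alternative serves (W), where the labels of the root of `T₂` move to `z`.
  node_inr : ∀ j, (∃ q, C.node (.inr j) = e (.inr q) ∧ g q = T₂.node j) ∨
    (C.node (.inr j) = e (.inl z) ∧ (∀ v, ¬ T₂.Anc (T₂.node j) (g v)) ∧
      T₁.dots (f z) = T₁.dots (T₁.node x) + T₂.dots (T₂.node j))
  red_inl : ∀ v, C.red (e (.inl v)) ↔ T₁.red (f v)
  red_inr : ∀ w, C.red (e (.inr w)) ↔ T₂.red (g w)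
  dotted_inl : ∀ v, C.dotted (e (.inl v)) ↔ T₁.dotted (f v)

namespace Grafting

variable {T₁ : DottedTree I} {x : I} {T₂ : DottedTree J} {C : DottedTree (Ins x J)}
  {M N : Type} (G : Grafting T₁ x T₂ C M N)

/-- The ancestor relation of the grafted tree. -/
def ancSum : M ⊕ N → M ⊕ N → Prop
  | .inl w, .inl v => T₁.Anc (G.f w) (G.f v)
  | .inl _, .inr _ => False
  | .inr _, .inl v => T₁.Anc (G.f G.z) (G.f v)
  | .inr w, .inr v => T₂.Anc (G.g w) (G.g v)

/-- The relation `ancSum` satisfies the recursion of `anc_unique`: an attached node leaves `N` for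
`z`, and its only ancestor within `N` is itself. -/
theorem anc (w v : M ⊕ N) : C.Anc (G.e w) (G.e v) ↔ G.ancSum w v := by
  suffices h : ∀ w v, C.Anc w v ↔ G.ancSum (G.e.symm w) (G.e.symm v) by simp [h]
  refine anc_unique C (fun w v => G.ancSum (G.e.symm w) (G.e.symm v)) fun w v => ?_
  obtain ⟨w, rfl⟩ := G.e.surjective w
  obtain ⟨v, rfl⟩ := G.e.surjective v
  rw [G.e.injective.eq_iff, Equiv.symm_apply_apply, Equiv.symm_apply_apply]
  rcases w with w | w
  · rcases G.parent_inl w with ⟨h, h'⟩ | ⟨q, h, h'⟩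
    · rcases v with v | v
      · simp [h', ancSum, T₁.anc_iff (w := G.f w), h, G.f_injective.eq_iff]
      · simp [h', ancSum]
    · rcases v with v | v
      · simp [h', ancSum, T₁.anc_iff (w := G.f w), h, G.f_injective.eq_iff]
      · simp [h', ancSum]
  · rcases G.parent_inr w with ⟨q, h, h', -⟩ | ⟨h', h, -⟩
    · rcases v with v | v
      · simp [h', ancSum]
      · simp [h', ancSum, T₂.anc_iff (w := G.g w), h, G.g_injective.eq_iff]
    · rcases v with v | v
      · simp [h', ancSum]
      · simp only [h', ancSum, Option.some.injEq, exists_eq_left', Equiv.symm_apply_apply,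
          or_false, Sum.inr.injEq]
        exact ⟨fun h1 => G.g_injective (h v h1), fun h1 => h1 ▸ Anc.refl _⟩

/-- By `anc_z`, a kept node of `T₁` has the labels of `J` below it exactly when it had `x` below it.
-/
theorem symbol_inl [Nonempty J] (v : M) :
    C.symbol (G.e (.inl v)) = FSymbol.subst x J (T₁.symbol (G.f v)) := by
  refine Subtype.ext (Set.ext fun t => ?_)
  change C.Anc (C.node t) (G.e (.inl v)) ↔ T₁.Anc (T₁.node (Ins.collapse x J t)) (G.f v)
  rcases t with t | t
  · obtain ⟨m, hm, hm'⟩ := G.node_inl t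
    rw [hm, G.anc]
    change T₁.Anc (G.f m) _ ↔ T₁.Anc (T₁.node t.1) _
    rw [hm']
  · refine Iff.trans ?_ (G.anc_z v).symm
    rcases G.node_inr t with ⟨q, h, -⟩ | ⟨h, -⟩ <;> rw [h, G.anc] <;> rfl

theorem symbol_inr (w : N) :
    C.symbol (G.e (.inr w)) = FSymbol.image Sum.inr (T₂.symbol (G.g w)) := by
  refine Subtype.ext (Set.ext fun t => ?_)
  change C.Anc (C.node t) (G.e (.inr w)) ↔ _
  rcases t with t | t
  · obtain ⟨m, hm, -⟩ := G.node_inl t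
    rw [hm, G.anc]
    exact iff_of_false id (by simp [FSymbol.image])
  · rw [FSymbol.inr_mem_image]
    change _ ↔ T₂.Anc (T₂.node t) (G.g w)
    rcases G.node_inr t with ⟨q, h, h'⟩ | ⟨h, h', -⟩
    · rw [h, G.anc, ← h']
      rfl
    · rw [h, G.anc]
      exact iff_of_false id (h' w)

open Classical in
theorem dots_inl (v : M) : C.dots (G.e (.inl v)) = T₁.dots (G.f v) := by
  generalize hw : G.f v = w
  induction w using T₁.wf.induction generalizing v with
  | _ w ih =>
    subst hw
    rcases G.parent_inl v with ⟨h, h'⟩ | ⟨q, h, h'⟩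
    · rw [(C.parent_eq_none _).1 h', (T₁.parent_eq_none _).1 h, dots_root, dots_root]
    · rw [C.dots_of_parent h', T₁.dots_of_parent h, ih _ h q rfl]
      simp only [G.dotted_inl]

open Classical in
-- This is the tree counterpart of replacing `u_x` by the product of the `u_b`: every label of `J`
-- inherits the dots above `x`.
theorem dots_inr (w : N) :
    C.dots (G.e (.inr w)) = T₁.dots (T₁.node x) + T₂.dots (G.g w) := by
  generalize hw : G.g w = y
  induction y using T₂.wf.induction generalizing w with
  | _ y ih =>
    subst hw
    rcases G.parent_inr w with ⟨q, h, h', hd⟩ | ⟨h, -, h'⟩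
    · rw [C.dots_of_parent h', T₂.dots_of_parent h, ih _ h q rfl, add_assoc]
      simp only [hd]
    · rw [C.dots_of_parent h, G.dots_inl, h']

theorem monomial_eq {T₁ : DottedTree I} {x : I} {T₂ : DottedTree J} {C : DottedTree (Ins x J)}
    {M N : Type} (G : Grafting T₁ x T₂ C M N) [Finite I] [Nonempty I] [Finite J] [Nonempty J] :
    C.monomial = monOperad.comp x T₁.monomial T₂.monomial := by
  funext t
  rcases t with t | t
  · obtain ⟨m, hm, hm'⟩ := G.node_inl t
    change C.dots (C.node _) = T₁.dots (T₁.node t.1) + 0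
    rw [hm, G.dots_inl, hm', add_zero]
  · change C.dots (C.node _) = T₁.dots (T₁.node x) + T₂.dots (T₂.node t)
    rcases G.node_inr t with ⟨q, h, h'⟩ | ⟨h, -, h'⟩
    · rw [h, G.dots_inr, h']
    · rw [h, G.dots_inl, h']

open Classical in
theorem factors_eq [Fintype M] [Fintype N] [Nonempty J] :
    C.factors = (∑ m, T₁.factor (G.f m)).mapDomain (FSymbol.subst x J) +
      (∑ n, T₂.factor (G.g n)).mapDomain (FSymbol.image Sum.inr) := by
  rw [C.factors_eq_sum G.e, Fintype.sum_sum_type, Finsupp.mapDomain_finsetSum,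
    Finsupp.mapDomain_finsetSum]
  simp only [factor, Finsupp.mapDomain_single, G.symbol_inl, G.symbol_inr, G.red_inl, G.red_inr]

open Classical in
-- The correction at a red root is the same on both sides, since `C` has a root of the same colour
-- as `T₁` and substitution takes the full symbol to the full symbol. Only the products of factors
-- of `T₁` and `C` remain to be compared.
theorem toMFF_eq [Finite I] [Nonempty I] [Finite J] [Nonempty J] [Fintype M] [Fintype N]
    (h : (∑ m, T₁.factor (G.f m)).mapDomain (FSymbol.subst x J) +
      (∑ n, T₂.factor (G.g n)).mapDomain (FSymbol.image Sum.inr) =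
      ffComp x T₁.factors T₂.fraction) :
    C.toMFF = mffOperad.comp x T₁.toMFF T₂.toMFF := by
  refine Prod.ext G.monomial_eq ?_
  change C.fraction = ffComp x T₁.fraction T₂.fraction
  obtain ⟨r, hr, hr'⟩ := G.root
  have h3 : FSymbol.subst x J (FSymbol.full I) = FSymbol.full (Ins x J) := rfl
  rw [fraction, G.factors_eq, h, hr, ffComp, ffComp, fraction.eq_1 T₁, Finsupp.mapDomain_sub]
  simp only [G.red_inl, hr']
  split_ifs
  · rw [Finsupp.mapDomain_single, h3]
    abel
  · rw [Finsupp.mapDomain_zero]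
    abel

end Grafting

/-- Here the root comes from `T₂` and no node of `T₁` survives, so the rule is not a `Grafting`. The
fraction `1/[x]` of `T₁` becomes `1/[J]` and cancels the `[J]` of the composition. -/
theorem toMFF_compR1 [Finite I] [Nonempty I] [Finite J] [Nonempty J] (T₁ : DottedTree I)
    (x : I) (T₂ : DottedTree J) (hr : T₂.red T₂.root) (h : T₁.IsSingle x) :
    (compR1 x T₂ h.2).toMFF = mffOperad.comp x T₁.toMFF T₂.toMFF := by
  have hx : T₁.node x = T₁.root := (h.1 _).symm
  refine Prod.ext (funext fun t => ?_) ?_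
  · rcases t with t | t
    · exact absurd (h.2 t.1) t.2
    · change T₂.dots (T₂.node t) = T₁.dots (T₁.node x) + T₂.dots (T₂.node t)
      rw [hx, dots_root, zero_add]
  · change (compR1 x T₂ h.2).fraction = ffComp x T₁.fraction T₂.fraction
    have hw : ¬ T₁.red T₁.root := hx ▸ T₁.not_red_node x
    have h1 : T₁.factors = -Finsupp.single (FSymbol.full I) 1 := by
      rw [factors, Fintype.sum_eq_single T₁.root fun v hv => absurd ((h.1 v).trans hx) hv,
        factor, if_neg hw, symbol_root, Finsupp.single_neg]
    have hs (v : T₂.V) : (compR1 x T₂ h.2).symbol v = FSymbol.image Sum.inr (T₂.symbol v) := by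
      refine Subtype.ext (Set.ext fun t => ?_)
      rcases t with t | t
      · exact absurd (h.2 t.1) t.2
      · exact (FSymbol.inr_mem_image (T₂.symbol v) t).symm
    have h2 : (compR1 x T₂ h.2).factors = T₂.factors.mapDomain (FSymbol.image Sum.inr) :=
      factors_eq_mapDomain _ (Equiv.refl T₂.V) hs fun _ => Iff.rfl
    have hr' : (compR1 x T₂ h.2).red (compR1 x T₂ h.2).root := hr
    have hf : FSymbol.image Sum.inr (FSymbol.full J) = FSymbol.full (Ins x J) := by
      refine Subtype.ext (Set.ext fun t => ?_)
      rcases t with t | t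
      · exact absurd (h.2 t.1) t.2
      · simp [FSymbol.image, FSymbol.full]
    have h3 : FSymbol.subst x J (FSymbol.full I) = FSymbol.full (Ins x J) := rfl
    rw [fraction, if_pos hr', ffComp, fraction, fraction, if_neg hw, if_pos hr, h1, h2,
      sub_zero, Finsupp.mapDomain_sub, ← Finsupp.single_neg, Finsupp.mapDomain_single,
      Finsupp.mapDomain_single, hf, h3, Finsupp.single_neg]
    abel

/-- The tree of rule (W) as a grafting. -/
noncomputable def graftingW (T₁ : DottedTree I) (x : I) (T₂ : DottedTree J)
    (hr : ¬ T₂.red T₂.root) :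
    Grafting T₁ x T₂ (compW T₁ x T₂ hr) T₁.V {w // w ≠ T₂.root} where
  f := id
  g := Subtype.val
  e := Equiv.refl _
  z := T₁.node x
  f_injective := Function.injective_id
  g_injective := Subtype.val_injective
  root := ⟨T₁.root, rfl, rfl⟩
  parent_inl v := by
    change (T₁.parent v = none ∧ (T₁.parent v).map Sum.inl = none) ∨
      ∃ q, T₁.parent v = some q ∧ (T₁.parent v).map Sum.inl = some (Sum.inl q)
    cases T₁.parent v <;> simp
  parent_inr w := by
    obtain ⟨p, hp⟩ := T₂.exists_parent w.2
    have h : (compW T₁ x T₂ hr).parent (Sum.inr w : T₁.V ⊕ {w // w ≠ T₂.root}) =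
        some (place (T₁.node x) T₂ p) := by
      change (T₂.parent w.1).map _ = _
      rw [hp]; rfl
    by_cases hr : p = T₂.root
    · subst hr
      refine .inr ⟨h.trans (congrArg some (place_eq_inl.2 ⟨rfl, rfl⟩)), fun v hv => ?_,
        (congrArg (T₁.dots (T₁.node x) + ·) ?_)⟩
      · rcases (T₂.anc_iff_of_parent hp).1 hv with h | h
        · exact h
        · exact absurd (T₂.anc_root_iff.1 h).symm v.2
      · refine Eq.trans ?_ (T₂.dots_of_parent hp).symm
        rw [dots_root, zero_add]
        rfl
    · exact .inl ⟨⟨p, hr⟩, hp, h.trans (congrArg some (place_eq_inr.2 rfl)), Iff.rfl⟩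
  anc_z v := Iff.rfl
  node_inl a := ⟨_, rfl, rfl⟩
  node_inr j := by
    by_cases hj : T₂.node j = T₂.root
    · refine .inr ⟨place_eq_inl.2 ⟨hj, rfl⟩, fun v hv => ?_, ?_⟩
      · rw [hj, anc_root_iff] at hv
        exact v.2 hv.symm
      · rw [hj, dots_root]; rfl
    · exact .inl ⟨⟨_, hj⟩, place_eq_inr.2 rfl, rfl⟩
  red_inl v := Iff.rfl
  red_inr w := Iff.rfl
  dotted_inl v := Iff.rfl

/-- The root of `T₂` disappears: its factor `1/[J]` cancels the `[J]` of the composition. -/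
theorem toMFF_compW [Finite I] [Nonempty I] [Finite J] [Nonempty J] (T₁ : DottedTree I) (x : I)
    (T₂ : DottedTree J) (hr : ¬ T₂.red T₂.root) :
    (compW T₁ x T₂ hr).toMFF = mffOperad.comp x T₁.toMFF T₂.toMFF := by
  classical
  refine (graftingW T₁ x T₂ hr).toMFF_eq ?_
  change (∑ m, T₁.factor m).mapDomain _ +
    (∑ n : {w // w ≠ T₂.root}, T₂.factor n.1).mapDomain _ = _
  rw [Fintype.sum_subtype_ne T₂.root T₂.factor, Finsupp.mapDomain_sub, factor, if_neg hr,
    symbol_root, Finsupp.mapDomain_single, Finsupp.single_neg, ffComp, fraction, if_neg hr,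
    sub_zero, ← factors, ← factors]
  abel

/-- The tree of rule (R2) as a grafting. -/
noncomputable def graftingR2 (T₁ : DottedTree I) (x : I) (T₂ : DottedTree J)
    (hr : T₂.red T₂.root)
    (hz : ¬ T₁.IsLeaf (T₁.node x) ∨ ∃ a, a ≠ x ∧ T₁.node a = T₁.node x) :
    Grafting T₁ x T₂ (compR2 T₁ x T₂ hr hz) T₁.V T₂.V where
  f := id
  g := id
  e := Equiv.refl _
  z := T₁.node x
  f_injective := Function.injective_id
  g_injective := Function.injective_id
  root := ⟨T₁.root, rfl, rfl⟩
  parent_inl v := by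
    change (T₁.parent v = none ∧ (T₁.parent v).map Sum.inl = none) ∨
      ∃ q, T₁.parent v = some q ∧ (T₁.parent v).map Sum.inl = some (Sum.inl q)
    cases T₁.parent v <;> simp
  parent_inr w := by
    have h : (compR2 T₁ x T₂ hr hz).parent (Sum.inr w : T₁.V ⊕ T₂.V) =
        some ((T₂.parent w).elim (Sum.inl (T₁.node x)) Sum.inr) := rfl
    cases hp : T₂.parent w with
    | none =>
      rw [hp] at h
      obtain rfl := (T₂.parent_eq_none w).1 hp
      refine .inr ⟨h, fun v hv => T₂.anc_root_iff.1 hv,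
        (congrArg (T₁.dots (T₁.node x) + ·) ?_)⟩
      exact (if_neg T₂.not_dotted_root).trans T₂.dots_root.symm
    | some q =>
      rw [hp] at h
      exact .inl ⟨q, hp, h, Iff.rfl⟩
  anc_z v := Iff.rfl
  node_inl a := ⟨_, rfl, rfl⟩
  node_inr j := .inl ⟨T₂.node j, rfl, rfl⟩
  red_inl v := Iff.rfl
  red_inr w := Iff.rfl
  dotted_inl v := Iff.rfl

/-- All nodes survive. The `[J]` of the composition undoes the correction `1/[J]` made for the red
root of `T₂`. -/
theorem toMFF_compR2 [Finite I] [Nonempty I] [Finite J] [Nonempty J] (T₁ : DottedTree I) (x : I)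
    (T₂ : DottedTree J) (hr : T₂.red T₂.root)
    (hz : ¬ T₁.IsLeaf (T₁.node x) ∨ ∃ a, a ≠ x ∧ T₁.node a = T₁.node x) :
    (compR2 T₁ x T₂ hr hz).toMFF = mffOperad.comp x T₁.toMFF T₂.toMFF := by
  refine (graftingR2 T₁ x T₂ hr hz).toMFF_eq ?_
  change (∑ m, T₁.factor m).mapDomain _ + (∑ n, T₂.factor n).mapDomain _ = _
  rw [ffComp, fraction, if_pos hr, Finsupp.mapDomain_sub, Finsupp.mapDomain_single,
    ← factors, ← factors]
  abel

open Classical in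
/-- The tree of rule (R3) as a grafting. -/
noncomputable def graftingR3 (T₁ : DottedTree I) (x : I) (T₂ : DottedTree J)
    (hr : T₂.red T₂.root) (hl : T₁.IsLeaf (T₁.node x))
    (hx : ∀ a, T₁.node a = T₁.node x → a = x) (z' : {v : T₁.V // v ≠ T₁.node x})
    (hz' : T₁.parent (T₁.node x) = some z'.1) :
    Grafting T₁ x T₂ (compR3 T₁ x T₂ hr hl hx z' hz') {v // v ≠ T₁.node x}
      {w // w ≠ T₂.root} where
  f := Subtype.val
  g := Subtype.val
  e := Equiv.refl _
  z := z'
  f_injective := Subtype.val_injective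
  g_injective := Subtype.val_injective
  root := ⟨_, rfl, rfl⟩
  parent_inl v := by
    have h : (compR3 T₁ x T₂ hr hl hx z' hz').parent
        (Sum.inl v : {v // v ≠ T₁.node x} ⊕ {w // w ≠ T₂.root}) =
        (T₁.parent v.1).map fun p => Sum.inl (avoid T₁ (T₁.node x) z' p) := rfl
    cases hp : T₁.parent v.1 with
    | none => rw [hp] at h; exact .inl ⟨rfl, h⟩
    | some q =>
      rw [hp] at h
      have hq : q ≠ T₁.node x := by rintro rfl; exact hl _ hp
      refine .inr ⟨⟨q, hq⟩, rfl, h.trans (congrArg some ?_)⟩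
      exact congrArg Sum.inl ((avoid_eq hq).2 rfl)
  parent_inr w := by
    obtain ⟨p, hp⟩ := T₂.exists_parent w.2
    have h : (compR3 T₁ x T₂ hr hl hx z' hz').parent
        (Sum.inr w : {v // v ≠ T₁.node x} ⊕ {w // w ≠ T₂.root}) = some (place z' T₂ p) := by
      change (T₂.parent w.1).map _ = _
      rw [hp]; rfl
    have hd : (compR3 T₁ x T₂ hr hl hx z' hz').dotted
        (Sum.inr w : {v // v ≠ T₁.node x} ⊕ {w // w ≠ T₂.root}) ↔
        T₂.dotted w.1 ∨ (p = T₂.root ∧ T₁.dotted (T₁.node x)) := by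
      change T₂.dotted w.1 ∨ (T₂.parent w.1 = some T₂.root ∧ _) ↔ _
      rw [hp, Option.some.injEq]
    by_cases hpr : p = T₂.root
    · subst hpr
      refine .inr ⟨h.trans (congrArg some (place_eq_inl.2 ⟨rfl, rfl⟩)), fun v hv => ?_, ?_⟩
      · rcases (T₂.anc_iff_of_parent hp).1 hv with h | h
        · exact h
        · exact absurd (T₂.anc_root_iff.1 h).symm v.2
      · have h1 : ¬ T₂.dotted w.1 := T₂.not_dotted_of_parent_red hp hr
        rw [T₂.dots_of_parent hp, dots_root, if_neg h1, T₁.dots_of_parent hz']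
        simp only [h1, false_or, true_and] at hd
        rw [add_zero, add_zero]
        exact congrArg (T₁.dots z'.1 + ·) (if_congr hd rfl rfl)
    · refine .inl ⟨⟨p, hpr⟩, hp, h.trans (congrArg some (place_eq_inr.2 rfl)), hd.trans ?_⟩
      simp [hpr]
  -- Nodes of `M` differ from the removed leaf, and any other ancestor of that leaf is an ancestor
  -- of its parent.
  anc_z v := (T₁.anc_iff_of_parent hz').trans (or_iff_right v.2.symm)
  node_inl a := ⟨_, rfl, rfl⟩
  node_inr j := .inl ⟨_, rfl, rfl⟩
  red_inl v := Iff.rfl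
  red_inr w := Iff.rfl
  dotted_inl v := Iff.rfl

/-- Two nodes disappear. The factor `1/[x]` of the leaf becomes `1/[J]` and cancels the `[J]` of the
composition; the factor `[J]` of the red root of `T₂` is already cancelled in its fraction. -/
theorem toMFF_compR3 [Finite I] [Nonempty I] [Finite J] [Nonempty J] (T₁ : DottedTree I) (x : I)
    (T₂ : DottedTree J) (hr : T₂.red T₂.root) (hl : T₁.IsLeaf (T₁.node x))
    (hx : ∀ a, T₁.node a = T₁.node x → a = x) (z' : {v : T₁.V // v ≠ T₁.node x})
    (hz' : T₁.parent (T₁.node x) = some z'.1) :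
    (compR3 T₁ x T₂ hr hl hx z' hz').toMFF = mffOperad.comp x T₁.toMFF T₂.toMFF := by
  classical
  have hs : FSymbol.subst x J (T₁.symbol (T₁.node x)) =
      FSymbol.image Sum.inr (FSymbol.full J) := by
    refine Subtype.ext (Set.ext fun t => ?_)
    change T₁.Anc (T₁.node (Ins.collapse x J t)) (T₁.node x) ↔ _
    rcases t with t | t
    · refine iff_of_false (fun h => ?_) (by simp [FSymbol.image])
      rcases T₁.anc_iff_child.1 h with h | ⟨c, hc, -⟩
      · exact t.2 (hx _ h)
      · exact hl c hc
    · exact iff_of_true (Anc.refl _) (by simp [FSymbol.image, FSymbol.full])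
  refine (graftingR3 T₁ x T₂ hr hl hx z' hz').toMFF_eq ?_
  change (∑ m : {v // v ≠ T₁.node x}, T₁.factor m.1).mapDomain _ +
    (∑ n : {w // w ≠ T₂.root}, T₂.factor n.1).mapDomain _ = _
  rw [Fintype.sum_subtype_ne T₂.root T₂.factor, Fintype.sum_subtype_ne (T₁.node x) T₁.factor,
    Finsupp.mapDomain_sub, Finsupp.mapDomain_sub, factor, factor, if_pos hr,
    if_neg (T₁.not_red_node x), symbol_root, Finsupp.mapDomain_single, Finsupp.mapDomain_single,
    hs, Finsupp.single_neg, ffComp, fraction, if_pos hr, Finsupp.mapDomain_sub,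
    Finsupp.mapDomain_single, ← factors, ← factors]
  abel

theorem toMFF_comp [Finite I] [Nonempty I] [Finite J] [Nonempty J] (x : I) (T₁ : DottedTree I)
    (T₂ : DottedTree J) : (comp x T₁ T₂).toMFF = mffOperad.comp x T₁.toMFF T₂.toMFF := by
  unfold comp
  split_ifs with hr h1 h2
  · exact toMFF_compR1 T₁ x T₂ hr h1
  · exact toMFF_compR2 T₁ x T₂ hr h2
  · exact toMFF_compR3 T₁ x T₂ hr _ _ _ _
  · exact toMFF_compW T₁ x T₂ hr

end DottedTree

/-! ### Recovering a tree from its fraction and its monomial. -/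

namespace DottedTree

variable {I : Type}

open Classical in
-- Distinct nodes have distinct symbols, so each exponent is the contribution of a single node.
theorem factors_apply (T : DottedTree I) (v : T.V) :
    T.factors (T.symbol v) = if T.red v then 1 else -1 := by
  rw [factors, Finsupp.finsetSum_apply, Finset.sum_eq_single v]
  · simp [factor]
  · intro w _ hw
    rw [factor, Finsupp.single_apply, if_neg fun h => hw (T.symbol_injective h)]
  · simp

theorem factors_apply_eq_zero (T : DottedTree I) {S : FSymbol I} (hS : ∀ v, T.symbol v ≠ S) :
    T.factors S = 0 := by
  rw [factors, Finsupp.finsetSum_apply]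
  exact Finset.sum_eq_zero fun v _ => Finsupp.single_eq_of_ne' (hS v)

open Classical in
theorem fraction_full [Nonempty I] (T : DottedTree I) :
    T.fraction (FSymbol.full I) = if T.red T.root then 0 else -1 := by
  rw [fraction, Finsupp.sub_apply, ← symbol_root T, factors_apply]
  split_ifs <;> simp

open Classical in
theorem fraction_of_ne [Nonempty I] (T : DottedTree I) {S : FSymbol I} (hS : S ≠ FSymbol.full I) :
    T.fraction S = T.factors S := by
  rw [fraction, Finsupp.sub_apply]
  split_ifs <;> simp [hS]

/-- The full symbol is listed apart because at a red root its exponent is cancelled by the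
correction. -/
theorem mem_range_symbol [Nonempty I] (T : DottedTree I) (S : FSymbol I) :
    S ∈ Set.range T.symbol ↔ S = FSymbol.full I ∨ T.fraction S ≠ 0 := by
  classical
  by_cases hS : S = FSymbol.full I
  · exact iff_of_true ⟨T.root, T.symbol_root.trans hS.symm⟩ (.inl hS)
  · rw [T.fraction_of_ne hS]
    constructor
    · rintro ⟨v, rfl⟩
      rw [factors_apply]
      right
      split_ifs <;> simp
    · rintro (h | h)
      · exact absurd h hS
      · by_contra h'
        exact h (T.factors_apply_eq_zero fun v hv => h' ⟨v, hv⟩)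

theorem red_iff_fraction [Nonempty I] (T : DottedTree I) (v : T.V) :
    T.red v ↔ (T.symbol v = FSymbol.full I ∧ T.fraction (T.symbol v) = 0) ∨
      (T.symbol v ≠ FSymbol.full I ∧ T.fraction (T.symbol v) = 1) := by
  classical
  by_cases hS : T.symbol v = FSymbol.full I
  · have hv : v = T.root := T.symbol_injective (hS.trans T.symbol_root.symm)
    rw [hS, fraction_full, hv]
    split_ifs with h <;> simp [h]
  · rw [T.fraction_of_ne hS, factors_apply]
    split_ifs with h <;> simp [h, hS]

/-- The parent is the closest strict ancestor. Together with `node_eq_iff`, this makes the shape of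
the tree depend only on the order between nodes and on the sets of labels below them. -/
theorem parent_eq_some_iff (T : DottedTree I) (c p : T.V) :
    T.parent c = some p ↔ T.Anc c p ∧ c ≠ p ∧ ∀ q, T.Anc c q → c ≠ q → T.Anc p q := by
  constructor
  · intro h
    refine ⟨.of_parent h, ?_, fun q hq hne => ?_⟩
    · rintro rfl
      exact T.parent_ne_self _ h
    · exact ((T.anc_iff_of_parent h).1 hq).resolve_left hne
  · rintro ⟨h, hne, hmin⟩
    rcases T.anc_iff.1 h with h | ⟨q, hq, hqp⟩
    · exact absurd h hne
    · have hcq : c ≠ q := by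
        rintro rfl
        exact T.parent_ne_self _ hq
      rw [hq, hqp.antisymm (hmin q (.of_parent hq) hcq)]

theorem node_eq_iff (T : DottedTree I) (i : I) (v : T.V) :
    T.node i = v ↔ i ∈ T.desc v ∧ ∀ w, i ∈ T.desc w → T.Anc v w := by
  constructor
  · rintro rfl
    exact ⟨Anc.refl _, fun w h => h⟩
  · rintro ⟨h, h'⟩
    exact Anc.antisymm h (h' _ (Anc.refl _))

/-- Dots only accumulate downwards, and `exists_dots_eq` provides a label where none is added. The
number of dots is thus a minimum of exponents of the monomial. -/
theorem dots_eq_iff (T : DottedTree I) (v : T.V) (n : ℕ) :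
    T.dots v = n ↔ (∀ i ∈ T.desc v, n ≤ T.monomial i) ∧ ∃ i ∈ T.desc v, T.monomial i = n := by
  have h : ∀ i ∈ T.desc v, T.dots v ≤ T.monomial i := fun i hi => T.dots_le_of_anc hi
  constructor
  · rintro rfl
    exact ⟨h, T.exists_dots_eq v⟩
  · rintro ⟨h1, i, hi, rfl⟩
    obtain ⟨j, hj, hj'⟩ := T.exists_dots_eq v
    exact le_antisymm (h i hi) ((h1 j hj).trans hj'.le)

theorem dotted_iff_dots (T : DottedTree I) (v : T.V) :
    T.dotted v ↔ ∃ p, T.parent v = some p ∧ T.dots v ≠ T.dots p := by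
  classical
  constructor
  · intro h
    obtain ⟨p, hp, -⟩ := T.dotted_white v h
    refine ⟨p, hp, ?_⟩
    rw [T.dots_of_parent hp, if_pos h]
    simp
  · rintro ⟨p, hp, h⟩
    by_contra hd
    rw [T.dots_of_parent hp, if_neg hd] at h
    exact h rfl

theorem equiv_of_toMFF_eq [Finite I] [Nonempty I] {T T' : DottedTree I} (h : T.toMFF = T'.toMFF) :
    T ≈ T' := by
  have hm : T.monomial = T'.monomial := congrArg Prod.fst h
  have hF : T.fraction = T'.fraction := congrArg Prod.snd h
  have hr : Set.range T.symbol = Set.range T'.symbol := by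
    ext S
    rw [mem_range_symbol, mem_range_symbol, hF]
  -- Nodes are matched when they have the same symbol; the two sets of symbols agree by `hr`.
  let e : T.V ≃ T'.V := (Equiv.ofInjective _ T.symbol_injective).trans
    ((Equiv.setCongr hr).trans (Equiv.ofInjective _ T'.symbol_injective).symm)
  have he (v : T.V) : T'.symbol (e v) = T.symbol v :=
    congrArg Subtype.val ((Equiv.ofInjective _ T'.symbol_injective).apply_symm_apply
      (Equiv.setCongr hr (Equiv.ofInjective _ T.symbol_injective v)))
  have hd (v : T.V) : T'.desc (e v) = T.desc v := congrArg Subtype.val (he v)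
  have ha (w v : T.V) : T'.Anc (e w) (e v) ↔ T.Anc w v := by
    rw [← desc_subset_iff, ← desc_subset_iff, hd, hd]
  have hp (c p : T.V) : T'.parent (e c) = some (e p) ↔ T.parent c = some p := by
    rw [parent_eq_some_iff, parent_eq_some_iff, ← e.forall_congr_right]
    simp only [ha, ne_eq, e.injective.eq_iff]
  have hc (v : T.V) : T'.dots (e v) = T.dots v := by
    rw [dots_eq_iff, ← hm, hd, ← dots_eq_iff]
  refine ⟨⟨e, fun v => ?_, fun i => ?_, fun v => ?_, fun v => ?_⟩⟩
  · cases hv : T.parent v with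
    | some p => exact (hp v p).2 hv
    | none =>
      cases hv' : T'.parent (e v) with
      | none => rfl
      | some p =>
        obtain ⟨p, rfl⟩ := e.surjective p
        rw [(hp v p).1 hv'] at hv
        cases hv
  · rw [node_eq_iff, ← e.forall_congr_right]
    simp only [ha, hd]
    exact (T.node_eq_iff i _).1 rfl
  · rw [red_iff_fraction, red_iff_fraction, he, hF]
  · rw [dotted_iff_dots, dotted_iff_dots, ← e.exists_congr_right]
    simp only [hp, hc]

end DottedTree

/-! ### Combining elements of `FF₆^Σ` on disjoint sets of labels. -/

/-- The union of two symbols. -/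
def FSymbol.union {I : Type} (S T : FSymbol I) : FSymbol I := ⟨S.1 ∪ T.1, S.2.inl⟩

section

open Finsupp

variable {I : Type}

open Classical in
/-- `GeneratedOn S m F` says that the pair of the monomial `m` in the variables of `S` and of the
fraction `F/[S]` belongs to `FF₆^Σ`, up to an injective relabelling with image `S`. -/
def GeneratedOn (S : FSymbol I) (m : I → ℕ) (F : FSymbol I →₀ ℤ) : Prop :=
  ∃ (K : Type) (_ : Finite K) (_ : Nonempty K) (h : K → I) (μ : K → ℕ) (A : FSymbol K →₀ ℤ),
    Function.Injective h ∧ FSymbol.image h (FSymbol.full K) = S ∧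
    mffOperad.Generated ff6Generators K (μ, A) ∧ (∀ k, m (h k) = μ k) ∧
    (∀ i, i ∉ S.1 → m i = 0) ∧ A.mapDomain (FSymbol.image h) + single S 1 = F

theorem generatedOn_singleton (S : FSymbol I) (i : I) (hS : S.1 = {i}) :
    GeneratedOn S 0 0 := by
  have h : FSymbol.image (fun _ : Unit => i) (FSymbol.full Unit) = S :=
    Subtype.ext (by simp [FSymbol.image, FSymbol.full, hS])
  refine ⟨Unit, inferInstance, inferInstance, fun _ => i, 0, -single (FSymbol.full Unit) 1,
    Function.injective_of_subsingleton _, h, .one, fun _ => rfl, fun _ _ => rfl, ?_⟩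
  rw [← single_neg, mapDomain_single, h, ← single_add]
  simp

/-- Two disjoint elements are combined by a generator of arity two. -/
theorem GeneratedOn.comp {S S' U : FSymbol I} {m m' : I → ℕ} {F F' : FSymbol I →₀ ℤ}
    (h : GeneratedOn S m F) (h' : GeneratedOn S' m' F') (hS : Disjoint S.1 S'.1)
    (hU : U = S.union S') (ν : Fin 2 → ℕ) (a b c : ℤ)
    (hg : ((ν, a • sym1 + b • sym2 + c • sym12) : mffOperad.obj (Fin 2)) ∈ ff6Generators)
    {n : I → ℕ} (hn : ∀ i ∈ S.1, n i = ν 0) (hn' : ∀ i ∈ S'.1, n i = ν 1)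
    (hn'' : ∀ i, i ∉ U.1 → n i = 0) :
    GeneratedOn U (m + m' + n) (F + F' + single S a + single S' b + single U (c + 1)) := by
  subst hU
  obtain ⟨K, _, _, f, μ, A, hf, rfl, hA, hm, hm0, rfl⟩ := h
  obtain ⟨K', _, _, f', μ', A', hf', rfl, hA', hm', hm0', rfl⟩ := h'
  have hff (k : K) (k' : K') : f k ≠ f' k' := fun e =>
    Set.disjoint_left.1 hS ⟨k, trivial, rfl⟩ ⟨k', trivial, e.symm⟩
  have h10 : (1 : Fin 2) ≠ 0 := by decide
  -- The second input of the generator, once its first input has been replaced by `K`.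
  let y : Ins (0 : Fin 2) K := Sum.inl ⟨1, h10⟩
  have hy (t : {t : Fin 2 // t ≠ 0}) : (Sum.inl t : Ins (0 : Fin 2) K) = y := by
    have : t = ⟨1, h10⟩ := Subtype.ext (Fin.eq_one_of_ne_zero _ t.2)
    rw [this]
  -- The value `f (Classical.arbitrary K)` is never reached: `y` is the only remaining input of the
  -- generator, and it has been removed.
  let g : Ins y K' → I :=
    Sum.elim (fun t => Sum.elim (fun _ => f (Classical.arbitrary K)) f t.1) f'
  refine ⟨Ins y K', inferInstance, inferInstance, g, _, _, ?_, ?_,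
    .comp y _ _ (.comp 0 _ _ (.gen _ hg) hA) hA', ?_, ?_, ?_⟩
  · rintro (⟨t | t, ht⟩ | t) (⟨s | s, hs⟩ | s) e
    · exact absurd (hy t) ht
    · exact absurd (hy t) ht
    · exact absurd (hy t) ht
    · exact absurd (hy s) hs
    · have : t = s := hf e
      subst this
      rfl
    · exact absurd e (hff _ _)
    · exact absurd (hy s) hs
    · exact absurd e.symm (hff _ _)
    · exact congrArg Sum.inr (hf' e)
  · refine Subtype.ext (Set.ext fun i => ⟨?_, ?_⟩)
    · rintro ⟨⟨t | t, ht⟩ | t, -, rfl⟩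
      · exact absurd (hy t) ht
      · exact .inl ⟨t, trivial, rfl⟩
      · exact .inr ⟨t, trivial, rfl⟩
    · rintro (⟨t, -, rfl⟩ | ⟨t, -, rfl⟩)
      · exact ⟨.inl ⟨.inr t, Sum.inr_ne_inl⟩, trivial, rfl⟩
      · exact ⟨.inr t, trivial, rfl⟩
  · rintro (⟨t | t, ht⟩ | t)
    · exact absurd (hy t) ht
    · change m (f t) + m' (f t) + n (f t) = ν 0 + μ t + 0
      rw [hm, hn _ ⟨t, trivial, rfl⟩, hm0' _ (by rintro ⟨k', -, e⟩; exact hff _ _ e.symm)]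
      ring
    · change m (f' t) + m' (f' t) + n (f' t) = ν 1 + 0 + μ' t
      rw [hm', hn' _ ⟨t, trivial, rfl⟩, hm0 _ (by rintro ⟨k', -, e⟩; exact hff _ _ e)]
      ring
  · intro i hi
    have h1 := hn'' i hi
    have h2 := hm0 i fun h => hi (.inl h)
    have h3 := hm0' i fun h => hi (.inr h)
    simp [h1, h2, h3]
  · change (ffComp y (ffComp 0 (a • sym1 + b • sym2 + c • sym12) A) A').mapDomain
      (FSymbol.image g) + _ = _
    -- The effect of both substitutions on the symbols of the generator: `[1]`, `[2]`, `[12]` become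
    -- the symbols of `S`, `S'` and their union.
    let σ : FSymbol (Fin 2) → FSymbol I :=
      FSymbol.image g ∘ FSymbol.subst y K' ∘ FSymbol.subst 0 K
    have hσ (T : FSymbol (Fin 2)) (i : I) : i ∈ (σ T).1 ↔
        (0 ∈ T.1 ∧ ∃ k, f k = i) ∨ (1 ∈ T.1 ∧ ∃ k, f' k = i) := by
      constructor
      · rintro ⟨⟨t | t, ht⟩ | t, h, rfl⟩
        · exact absurd (hy t) ht
        · exact .inl ⟨h, t, rfl⟩
        · exact .inr ⟨h, t, rfl⟩
      · rintro (⟨h, t, rfl⟩ | ⟨h, t, rfl⟩)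
        · exact ⟨.inl ⟨.inr t, Sum.inr_ne_inl⟩, h, rfl⟩
        · exact ⟨.inr t, h, rfl⟩
    have h1 : σ ⟨{0}, Set.singleton_nonempty _⟩ = FSymbol.image f (FSymbol.full K) :=
      Subtype.ext (Set.ext fun i => by rw [hσ]; simp [FSymbol.image, FSymbol.full])
    have h2 : σ ⟨{1}, Set.singleton_nonempty _⟩ = FSymbol.image f' (FSymbol.full K') :=
      Subtype.ext (Set.ext fun i => by rw [hσ]; simp [FSymbol.image, FSymbol.full])
    have h3 : σ ⟨{0, 1}, Set.insert_nonempty _ _⟩ =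
        (FSymbol.image f (FSymbol.full K)).union (FSymbol.image f' (FSymbol.full K')) :=
      Subtype.ext (Set.ext fun i => by
        rw [hσ]; simp [FSymbol.image, FSymbol.full, FSymbol.union])
    have h4 : FSymbol.image g ∘ FSymbol.subst y K' ∘ FSymbol.image Sum.inr =
        FSymbol.image f := by
      funext T
      refine Subtype.ext (Set.ext fun i => ⟨?_, ?_⟩)
      · rintro ⟨⟨t | t, ht⟩ | t, ⟨k, hk, e⟩, rfl⟩
        · exact absurd (hy t) ht
        · exact ⟨k, hk, congrArg f (Sum.inr_injective e)⟩
        · exact absurd e Sum.inr_ne_inl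
      · rintro ⟨k, hk, rfl⟩
        exact ⟨.inl ⟨.inr k, Sum.inr_ne_inl⟩, ⟨k, hk, rfl⟩, rfl⟩
    have h4' : FSymbol.image g (FSymbol.subst y K' (FSymbol.image Sum.inr (FSymbol.full K))) =
        FSymbol.image f (FSymbol.full K) := congrFun h4 _
    have h5 : g ∘ Sum.inr = f' := rfl
    have h6 : (a • sym1 + b • sym2 + c • sym12).mapDomain σ =
        single (FSymbol.image f (FSymbol.full K)) a +
        single (FSymbol.image f' (FSymbol.full K')) b +
        single ((FSymbol.image f (FSymbol.full K)).union
          (FSymbol.image f' (FSymbol.full K'))) c := by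
      simp only [sym1, sym2, sym12, smul_single, mapDomain_add, mapDomain_single, h1, h2, h3,
        smul_eq_mul, mul_one]
    rw [mapDomain_ffComp, h5]
    simp only [ffComp, mapDomain_add (f := FSymbol.image g ∘ FSymbol.subst y K'),
      mapDomain_single, ← mapDomain_comp, Function.comp_assoc, h4, Function.comp_apply, h4']
    change _ + (_ + mapDomain σ _ + _) + _ + _ = _
    rw [h6, single_add]
    abel

theorem zero_neg_sym12_mem_ff6Generators :
    (((0 : Fin 2 → ℕ), (0 : ℤ) • sym1 + (0 : ℤ) • sym2 + (-1 : ℤ) • sym12) :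
      mffOperad.obj (Fin 2)) ∈ ff6Generators := by
  refine .inr (.inr (.inl (Prod.ext rfl ?_)))
  change (0 : ℤ) • sym1 + (0 : ℤ) • sym2 + (-1 : ℤ) • sym12 = -sym12
  simp

namespace GeneratedOn

variable {S S' U : FSymbol I} {m m' : I → ℕ} {F F' : FSymbol I →₀ ℤ}

/-- Because of the normalisation by `[S]`, the generator `1/[12]` simply multiplies the two
fractions. -/
theorem merge (h : GeneratedOn S m F) (h' : GeneratedOn S' m' F') (hS : Disjoint S.1 S'.1)
    (hU : U = S.union S') : GeneratedOn U (m + m') (F + F') := by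
  have := h.comp h' hS hU 0 0 0 (-1) zero_neg_sym12_mem_ff6Generators (n := 0) (fun _ _ => rfl)
    (fun _ _ => rfl) (fun _ _ => rfl)
  simpa using this

/-- The generator `1/([2][12])` creates the factor `1/[S']` of a new white child. -/
theorem child (h : GeneratedOn S m F) (h' : GeneratedOn S' m' F') (hS : Disjoint S.1 S'.1)
    (hU : U = S.union S') : GeneratedOn U (m + m') (F + F' - single S' 1) := by
  have := h.comp h' hS hU 0 0 (-1) (-1)
    (.inr (.inl (Prod.ext rfl (by
      change (0 : ℤ) • sym1 + (-1 : ℤ) • sym2 + (-1 : ℤ) • sym12 = -sym2 - sym12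
      simp [sub_eq_add_neg])))) (n := 0) (fun _ _ => rfl)
    (fun _ _ => rfl) (fun _ _ => rfl)
  simpa [sub_eq_add_neg] using this

open Classical in
theorem dottedChild (h : GeneratedOn S m F) (h' : GeneratedOn S' m' F')
    (hS : Disjoint S.1 S'.1) (hU : U = S.union S') :
    GeneratedOn U (m + m' + fun i => if i ∈ S'.1 then 1 else 0) (F + F' - single S' 1) := by
  have := h.comp h' hS hU ![0, 1] 0 (-1) (-1)
    (.inr (.inr (.inr (.inr (.inr (Prod.ext rfl (by
      change (0 : ℤ) • sym1 + (-1 : ℤ) • sym2 + (-1 : ℤ) • sym12 = -sym2 - sym12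
      simp [sub_eq_add_neg])))))))
    (n := fun i => if i ∈ S'.1 then 1 else 0)
    (fun i hi => if_neg (Set.disjoint_left.1 hS hi)) (fun i hi => if_pos hi)
    (fun i hi => if_neg fun h => hi (hU ▸ .inr h))
  simpa [sub_eq_add_neg] using this

/-- The generator `1/([1][2])` creates the factors of two white siblings, and the normalisation
leaves `[U]`, the factor of a red parent. -/
theorem siblings (h : GeneratedOn S m F) (h' : GeneratedOn S' m' F') (hS : Disjoint S.1 S'.1)
    (hU : U = S.union S') :
    GeneratedOn U (m + m') (F + F' - single S 1 - single S' 1 + single U 1) := by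
  have := h.comp h' hS hU 0 (-1) (-1) 0
    (.inr (.inr (.inr (.inl (Prod.ext rfl (by
      change (-1 : ℤ) • sym1 + (-1 : ℤ) • sym2 + (0 : ℤ) • sym12 = -sym1 - sym2
      simp [sub_eq_add_neg])))))) (n := 0) (fun _ _ => rfl)
    (fun _ _ => rfl) (fun _ _ => rfl)
  simpa [sub_eq_add_neg] using this

/-- This is a single white node with label set `S`, obtained by merging its labels one at a time. -/
theorem zero_of_finite [Finite I] (S : FSymbol I) : GeneratedOn S 0 0 := by
  obtain ⟨S, hS⟩ := S
  have hf := S.toFinite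
  induction S, hf using Set.Finite.induction_on with
  | empty => exact absurd hS Set.not_nonempty_empty
  | @insert a s ha hs ih =>
    rcases s.eq_empty_or_nonempty with rfl | hne
    · exact generatedOn_singleton _ a (by simp)
    · have := (generatedOn_singleton ⟨{a}, Set.singleton_nonempty a⟩ a rfl).merge (ih hne)
        (U := ⟨insert a s, hS⟩) (by simpa using ha) (Subtype.ext (Set.insert_eq a s))
      simpa using this

end GeneratedOn

end

/-! ### Every tree gives an element of `FF₆^Σ`. -/

namespace DottedTree

variable {I : Type} (T : DottedTree I)

open Classical in
/-- The children of a node. -/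
noncomputable def children (v : T.V) : Finset T.V := Finset.univ.filter fun c => T.parent c = some v

theorem mem_children {v c : T.V} : c ∈ T.children v ↔ T.parent c = some v := by
  simp [children]

theorem mem_desc_iff_children {v : T.V} {i : I} :
    i ∈ T.desc v ↔ T.node i = v ∨ ∃ c ∈ T.children v, i ∈ T.desc c := by
  simp only [mem_children]
  exact T.anc_iff_child

theorem disjoint_desc {v c c' : T.V} (hc : c ∈ T.children v) (hc' : c' ∈ T.children v)
    (h : c ≠ c') : Disjoint (T.desc c) (T.desc c') :=
  Set.disjoint_left.2 fun _ hi hi' =>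
    h (T.eq_of_anc_of_parent (T.mem_children.1 hc) (T.mem_children.1 hc') hi hi')

section SumBelow

variable {M : Type*} [AddCommMonoid M]

open Classical in
/-- The sum of a function over a node and its descendants. -/
noncomputable def sumBelow (φ : T.V → M) (v : T.V) : M := ∑ w, if T.Anc w v then φ w else 0

theorem sumBelow_root (φ : T.V → M) : T.sumBelow φ T.root = ∑ w, φ w :=
  Finset.sum_congr rfl fun w _ => if_pos (T.anc_root w)

/-- Each strict descendant of `v` lies below exactly one child of `v`. -/
theorem sumBelow_eq (φ : T.V → M) (v : T.V) :
    T.sumBelow φ v = φ v + ∑ c ∈ T.children v, T.sumBelow φ c := by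
  classical
  have h1 : φ v = ∑ w, if w = v then φ w else 0 := by simp
  unfold sumBelow
  rw [Finset.sum_comm, h1, ← Finset.sum_add_distrib]
  refine Finset.sum_congr rfl fun w _ => ?_
  by_cases hw : w = v
  · subst hw
    rw [if_pos (Anc.refl w), if_pos rfl, Finset.sum_eq_zero, add_zero]
    exact fun c hc => if_neg (T.not_anc_of_parent (T.mem_children.1 hc))
  · rw [if_neg hw, zero_add]
    by_cases h : T.Anc w v
    · obtain ⟨c, hc, hwc⟩ := (T.anc_iff_child.1 h).resolve_left hw
      rw [if_pos h, Finset.sum_eq_single c, if_pos hwc]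
      · exact fun c' hc' hne => if_neg fun h' =>
          hne (T.eq_of_anc_of_parent (T.mem_children.1 hc') hc h' hwc)
      · exact fun h' => absurd (T.mem_children.2 hc) h'
    · rw [if_neg h, Finset.sum_eq_zero]
      exact fun c hc => if_neg fun h' => h (h'.trans (.of_parent (T.mem_children.1 hc)))

end SumBelow

open Classical in
/-- The monomial of the edge above a node. -/
noncomputable def edgeMonomial (v : T.V) (i : I) : ℕ := if T.dotted v ∧ i ∈ T.desc v then 1 else 0

theorem edgeMonomial_of_not_dotted {v : T.V} (h : ¬ T.dotted v) : T.edgeMonomial v = 0 :=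
  funext fun _ => if_neg fun h' => h h'.1

open Classical in
/-- The subtree at a node gives an element of `FF₆^Σ`. -/
def SubtreeGenerated (v : T.V) : Prop :=
  -- The edge above `v` is left out, since its dot is added when `v` is attached to its parent. For
  -- white `v` the normalisation by `[S]` absorbs the factor `1/[S]` of `v`; for red `v` it absorbs
  -- the root correction, so the factor `[S]` of `v` remains.
  GeneratedOn (T.symbol v) (∑ c ∈ T.children v, T.sumBelow T.edgeMonomial c)
    ((∑ c ∈ T.children v, T.sumBelow T.factor c) +
      if T.red v then Finsupp.single (T.symbol v) 1 else 0)

variable {T}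

theorem SubtreeGenerated.of_red {v : T.V} (h : T.SubtreeGenerated v) (hv : T.red v) :
    GeneratedOn (T.symbol v) (T.sumBelow T.edgeMonomial v) (T.sumBelow T.factor v) := by
  unfold SubtreeGenerated at h
  rw [if_pos hv] at h
  rw [sumBelow_eq, sumBelow_eq, T.edgeMonomial_of_not_dotted (T.not_dotted_of_red hv), zero_add,
    factor, if_pos hv, add_comm (Finsupp.single _ _)]
  exact h

theorem SubtreeGenerated.of_white {v : T.V} (h : T.SubtreeGenerated v) (hv : ¬ T.red v) :
    GeneratedOn (T.symbol v) (∑ c ∈ T.children v, T.sumBelow T.edgeMonomial c)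
      (T.sumBelow T.factor v + Finsupp.single (T.symbol v) 1) := by
  unfold SubtreeGenerated at h
  rw [if_neg hv, add_zero] at h
  rw [T.sumBelow_eq T.factor, factor, if_neg hv, Finsupp.single_neg, neg_add_cancel_comm]
  exact h

open Classical in
theorem SubtreeGenerated.graft {c : T.V} (h : T.SubtreeGenerated c) {S U : FSymbol I}
    {m : I → ℕ} {F : FSymbol I →₀ ℤ} (hS : GeneratedOn S m F) (hd : Disjoint S.1 (T.desc c))
    (hU : U = S.union (T.symbol c)) :
    GeneratedOn U (m + T.sumBelow T.edgeMonomial c) (F + T.sumBelow T.factor c) := by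
  by_cases hr : T.red c
  -- A red child already has its own factor in its normalised fraction, and the edge to it has no
  -- dot; a white child still lacks its factor.
  · exact hS.merge (h.of_red hr) hd hU
  · by_cases hdot : T.dotted c
    · have := hS.dottedChild (h.of_white hr) hd hU
      convert this using 1
      · rw [T.sumBelow_eq, add_assoc, add_comm (T.edgeMonomial c)]
        congr 2
        exact funext fun i => if_congr (and_iff_right hdot) rfl rfl
      · abel
    · have := hS.child (h.of_white hr) hd hU
      convert this using 1
      · rw [T.sumBelow_eq, T.edgeMonomial_of_not_dotted hdot, zero_add]
      · abel

theorem GeneratedOn.graft_children {v : T.V} (C : Finset T.V) (hC : C ⊆ T.children v)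
    (h : ∀ c ∈ C, T.SubtreeGenerated c) {S : FSymbol I} {m : I → ℕ} {F : FSymbol I →₀ ℤ}
    (hS : GeneratedOn S m F) (hd : ∀ c ∈ C, Disjoint S.1 (T.desc c)) {U : FSymbol I}
    (hU : ∀ i, i ∈ U.1 ↔ i ∈ S.1 ∨ ∃ c ∈ C, i ∈ T.desc c) :
    GeneratedOn U (m + ∑ c ∈ C, T.sumBelow T.edgeMonomial c)
      (F + ∑ c ∈ C, T.sumBelow T.factor c) := by
  classical
  induction C using Finset.induction generalizing U with
  | empty =>
    have : U = S := Subtype.ext (Set.ext fun i => by simp [hU])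
    simpa [this] using hS
  | insert a s ha ih =>
    let U' : FSymbol I := ⟨{i | i ∈ S.1 ∨ ∃ c ∈ s, i ∈ T.desc c}, S.2.imp fun _ => .inl⟩
    have h1 := ih (fun c hc => hC (Finset.mem_insert_of_mem hc))
      (fun c hc => h c (Finset.mem_insert_of_mem hc))
      (fun c hc => hd c (Finset.mem_insert_of_mem hc)) (U := U') fun i => Iff.rfl
    have h2 := (h a (Finset.mem_insert_self _ _)).graft h1 (U := U) ?_ ?_
    · rw [Finset.sum_insert ha, Finset.sum_insert ha, add_comm (T.sumBelow _ a),
        add_comm (T.sumBelow _ a), ← add_assoc, ← add_assoc]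
      exact h2
    · refine Set.disjoint_left.2 ?_
      rintro i (hi | ⟨c, hc, hi⟩) hi'
      · exact Set.disjoint_left.1 (hd a (Finset.mem_insert_self _ _)) hi hi'
      · refine Set.disjoint_left.1 (T.disjoint_desc (hC (Finset.mem_insert_of_mem hc))
          (hC (Finset.mem_insert_self _ _)) ?_) hi hi'
        rintro rfl
        exact ha hc
    · refine Subtype.ext (Set.ext fun i => (hU i).trans ?_)
      simp only [Finset.exists_mem_insert]
      exact (or_congr_right or_comm).trans or_assoc.symm

/-- The factor of the union is kept along the induction: adding a child trades the symbol of the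
previous union for its inverse, and `siblings` restores the inverse-free normalisation. -/
theorem generatedOn_siblings {v : T.V} {C : Finset T.V} (hne : C.Nonempty)
    (hC : C ⊆ T.children v) (h : ∀ c ∈ C, T.SubtreeGenerated c) (hw : ∀ c ∈ C, ¬ T.red c)
    (hd : ∀ c ∈ C, ¬ T.dotted c) {U : FSymbol I}
    (hU : ∀ i, i ∈ U.1 ↔ ∃ c ∈ C, i ∈ T.desc c) :
    GeneratedOn U (∑ c ∈ C, T.sumBelow T.edgeMonomial c)
      ((∑ c ∈ C, T.sumBelow T.factor c) + Finsupp.single U 1) := by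
  classical
  have key : ∀ c ∈ C, GeneratedOn (T.symbol c) (T.sumBelow T.edgeMonomial c)
      (T.sumBelow T.factor c + Finsupp.single (T.symbol c) 1) := fun c hc => by
    have := (h c hc).of_white (hw c hc)
    rw [T.sumBelow_eq T.edgeMonomial, T.edgeMonomial_of_not_dotted (hd c hc), zero_add]
    exact this
  clear h hw hd
  induction hne using Finset.Nonempty.cons_induction generalizing U with
  | singleton a =>
    have : U = T.symbol a := Subtype.ext (Set.ext fun i => by simp [hU, symbol])
    simpa [this] using key a
  | cons a s ha hs ih =>
    obtain ⟨c, hc⟩ := id hs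
    let U' : FSymbol I := ⟨{i | ∃ c ∈ s, i ∈ T.desc c},
      (T.desc_nonempty c).imp fun _ hi => ⟨c, hc, hi⟩⟩
    have h1 := ih (fun c hc => hC (Finset.mem_cons_of_mem hc)) (U := U') (fun i => Iff.rfl)
      (fun c hc => key c (Finset.mem_cons_of_mem hc))
    have h2 := h1.siblings (key a (Finset.mem_cons_self _ _)) (U := U) ?_ ?_
    · rw [Finset.sum_cons, Finset.sum_cons, add_comm (T.sumBelow T.edgeMonomial a)]
      convert h2 using 1
      abel
    · refine Set.disjoint_left.2 ?_
      rintro i ⟨c, hc, hi⟩ hi'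
      refine Set.disjoint_left.1 (T.disjoint_desc (hC (Finset.mem_cons_of_mem hc))
        (hC (Finset.mem_cons_self _ _)) ?_) hi hi'
      rintro rfl
      exact ha hc
    · refine Subtype.ext (Set.ext fun i => (hU i).trans ?_)
      simp only [Finset.mem_cons, exists_eq_or_imp]
      change _ ↔ _ ∨ i ∈ T.desc a
      exact or_comm

theorem subtreeGenerated [Finite I] (v : T.V) : T.SubtreeGenerated v := by
  classical
  induction v using T.induction_children with
  | h v ih =>
    replace ih : ∀ c ∈ T.children v, T.SubtreeGenerated c := fun c hc =>
      ih c (T.mem_children.1 hc)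
    unfold SubtreeGenerated
    by_cases hr : T.red v
    · obtain ⟨hl, hc⟩ := (T.red_iff v).1 hr
      obtain ⟨a, -, -, ha, -⟩ := T.two_children v hl
      rw [if_pos hr]
      refine generatedOn_siblings ⟨a, T.mem_children.2 ha⟩ subset_rfl ih
        (fun c h => hc c (T.mem_children.1 h))
        (fun c h => T.not_dotted_of_parent_red (T.mem_children.1 h) hr) fun i => ?_
      exact T.mem_desc_iff_children.trans (or_iff_right (hl i))
    rw [if_neg hr, add_zero]
    by_cases hl : ∃ i, T.node i = v
    · have h := GeneratedOn.graft_children (v := v) (T.children v) subset_rfl ih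
        (GeneratedOn.zero_of_finite ⟨{i | T.node i = v}, hl⟩) (U := T.symbol v) ?_
        fun i => T.mem_desc_iff_children
      · simpa using h
      · refine fun c hc => Set.disjoint_left.2 ?_
        intro i (hiv : T.node i = v) hi
        rw [mem_desc, hiv] at hi
        exact T.not_anc_of_parent (T.mem_children.1 hc) hi
    · push Not at hl
      -- With no label to start from, the construction starts from a red child. Its normalised
      -- fraction is exactly the product of the factors below it, whereas a white child would leave
      -- an extra symbol.
      obtain ⟨a, ha, har⟩ : ∃ a, T.parent a = some v ∧ T.red a := by
        rw [T.red_iff] at hr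
        push Not at hr
        exact hr hl
      rw [← T.mem_children] at ha
      rw [← Finset.add_sum_erase _ _ ha, ← Finset.add_sum_erase _ _ ha]
      refine GeneratedOn.graft_children (v := v) _ (Finset.erase_subset _ _)
        (fun c hc => ih c (Finset.mem_of_mem_erase hc)) ((ih a ha).of_red har)
        (fun c hc => ?_) fun i => ?_
      · obtain ⟨hca, hc⟩ := Finset.mem_erase.1 hc
        exact T.disjoint_desc ha hc hca.symm
      · refine (T.mem_desc_iff_children.trans (or_iff_right (hl i))).trans ?_
        nth_rw 1 [← Finset.insert_erase ha]
        rw [Finset.exists_mem_insert]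
        rfl

variable (T)

theorem generated_toMFF [Finite I] [Nonempty I] :
    mffOperad.Generated ff6Generators I T.toMFF := by
  classical
  obtain ⟨K, _, _, h, μ, A, hinj, hS, hg, hm, -, hF⟩ := subtreeGenerated T.root
  have hb : Function.Bijective h := by
    refine ⟨hinj, fun i => ?_⟩
    have : i ∈ (FSymbol.image h (FSymbol.full K)).1 := by
      rw [hS]
      exact T.anc_root _
    exact this.imp fun _ h => h.2
  let e := Equiv.ofBijective h hb
  -- Summing the edge monomials over all nodes, the exponent of a label counts the dotted edges
  -- above its node; the root contributes nothing.
  have h1 : ∑ c ∈ T.children T.root, T.sumBelow T.edgeMonomial c = T.monomial := by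
    have := T.sumBelow_eq T.edgeMonomial T.root
    rw [T.edgeMonomial_of_not_dotted T.not_dotted_root, zero_add, sumBelow_root] at this
    rw [← this]
    funext i
    rw [Finset.sum_apply]
    refine Finset.sum_congr rfl fun w _ => ?_
    simp only [edgeMonomial, and_comm, mem_desc]
  -- Removing the normalisation `[I]` gives the factor of a white root, or the correction at a red
  -- root.
  have h2 : A.mapDomain (FSymbol.image h) = T.fraction := by
    have := T.sumBelow_eq T.factor T.root
    rw [sumBelow_root, ← factors] at this
    rw [fraction, this, factor, eq_sub_of_add_eq hF, symbol_root]
    split_ifs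
    · abel
    · rw [Finsupp.single_neg]
      abel
  have h3 : mffOperad.map e (μ, A) = T.toMFF := by
    refine Prod.ext (funext fun i => ?_) h2
    obtain ⟨k, rfl⟩ := e.surjective i
    change μ (e.symm (e k)) = _
    rw [e.symm_apply_apply, ← hm, h1]
    rfl
  rw [← h3]
  exact .map e _ hg

end DottedTree

/-! ### The trees of the six generators. -/

namespace DottedTree

/-- The tree with one node and two labels. -/
def twoLabels : DottedTree (Fin 2) where
  V := Unit
  finite := inferInstance
  root := ()
  parent _ := none
  parent_eq_none := by simp
  wf := ⟨fun _ => ⟨_, fun _ h => by simp at h⟩⟩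
  node _ := ()
  two_children _ h := absurd rfl (h 0)
  red _ := False
  red_iff v := by simp
  dotted _ := False
  dotted_white := by simp

/-- The tree with two white nodes, where `r` is the label of the root; `d` says whether the edge
is dotted. -/
def edge (r : Fin 2) (d : Prop) : DottedTree (Fin 2) where
  V := Fin 2
  finite := inferInstance
  root := r
  parent v := if v = r then none else some r
  parent_eq_none := by simp
  wf := by
    have h : ∀ p c : Fin 2, (if c = r then none else some r) = some p → p = r ∧ c ≠ r := by
      intro p c
      split_ifs with h <;> simp [h, eq_comm]
    have hr : Acc (fun p c : Fin 2 => (if c = r then none else some r) = some p) r :=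
      ⟨_, fun p hp => absurd rfl (h p r hp).2⟩
    exact ⟨fun c => ⟨_, fun p hp => (h p c hp).1 ▸ hr⟩⟩
  node := id
  two_children v h := absurd rfl (h v)
  red _ := False
  red_iff v := by simp
  dotted v := d ∧ v ≠ r
  dotted_white v h := ⟨r, by simp [h.2], id, id⟩

/-- The tree with a red root and two leaves. -/
def redRoot : DottedTree (Fin 2) where
  V := Option (Fin 2)
  finite := inferInstance
  root := none
  parent v := v.map fun _ => none
  parent_eq_none := by simp
  wf := by
    have h : ∀ p c : Option (Fin 2), (c.map fun _ => (none : Option (Fin 2))) = some p →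
        p = none ∧ c ≠ none := by
      rintro p (_ | c) <;> simp [eq_comm]
    have hr : Acc (fun p c : Option (Fin 2) => (c.map fun _ => (none : Option (Fin 2))) = some p)
        none := ⟨_, fun p hp => absurd rfl (h p none hp).2⟩
    exact ⟨fun c => ⟨_, fun p hp => (h p c hp).1 ▸ hr⟩⟩
  node := some
  two_children := by
    rintro (_ | v) h
    · exact ⟨some 0, some 1, by simp, rfl, rfl⟩
    · exact absurd rfl (h v)
  red v := v = none
  red_iff := by
    rintro (_ | v)
    · refine iff_of_true rfl ⟨by simp, ?_⟩
      rintro (_ | c) <;> simp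
    · exact iff_of_false (by simp) fun h => h.1 v rfl
  dotted _ := False
  dotted_white := by simp

theorem toMFF_twoLabels : twoLabels.toMFF = ((0 : Fin 2 → ℕ), -sym12) := by
  refine Prod.ext (funext fun i => twoLabels.dots_root) ?_
  change twoLabels.fraction = -sym12
  have h : ¬ twoLabels.red twoLabels.root := id
  have h1 : twoLabels.factors = twoLabels.factor twoLabels.root := by
    rw [twoLabels.factors_eq_sum (Equiv.refl Unit), Fintype.sum_unique]
    rfl
  have h2 : (⟨{0, 1}, Set.insert_nonempty _ _⟩ : FSymbol (Fin 2)) = FSymbol.full _ :=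
    Subtype.ext (Set.eq_univ_of_forall (by simp [Fin.forall_fin_two]))
  rw [fraction, if_neg h, sub_zero, h1, factor, if_neg h, symbol_root, Finsupp.single_neg,
    sym12, h2]

theorem sym12_eq : sym12 = Finsupp.single (FSymbol.full (Fin 2)) 1 := by
  rw [sym12]
  congr 1
  exact Subtype.ext (Set.eq_univ_of_forall (by simp [Fin.forall_fin_two]))

section

variable (r s : Fin 2) (d : Prop)

theorem symbol_edge (h : s ≠ r) :
    (edge r d).symbol ((edge r d).node s) = ⟨{s}, Set.singleton_nonempty s⟩ := by
  refine Subtype.ext ((edge r d).desc_of_isLeaf fun (c : Fin 2) hc => ?_)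
  replace hc : (if c = r then none else some r) = some s := hc
  split_ifs at hc
  exact h (Option.some_injective _ hc).symm

theorem fraction_edge (h : s ≠ r) : (edge r d).fraction =
    -Finsupp.single ⟨{s}, Set.singleton_nonempty s⟩ 1 - sym12 := by
  have hw (v : (edge r d).V) : ¬ (edge r d).red v := id
  have h0 : (edge r d).factors = ∑ a : Fin 2, (edge r d).factor ((edge r d).node a) :=
    (edge r d).factors_eq_sum (Equiv.refl (Fin 2))
  have h1 : (Finset.univ : Finset (Fin 2)) = {s, r} := by
    ext i
    simp only [Finset.mem_univ, Finset.mem_insert, Finset.mem_singleton, true_iff]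
    omega
  have h2 : (edge r d).node r = (edge r d).root := rfl
  rw [fraction, if_neg (hw _), sub_zero, h0, h1, Finset.sum_pair h, factor_of_not_red _ (hw _),
    factor_of_not_red _ (hw _), h2, symbol_root, symbol_edge r s d h, sym12_eq, sub_eq_add_neg]

open Classical in
theorem monomial_edge (i : Fin 2) :
    (edge r d).monomial i = if d ∧ i ≠ r then 1 else 0 := by
  have hd : (edge r d).dotted ((edge r d).node i) ↔ d ∧ i ≠ r := Iff.rfl
  rw [monomial]
  by_cases hi : i = r
  · rw [if_neg (by simp [hi]), hi]
    exact (edge r d).dots_root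
  · have hp : (edge r d).parent ((edge r d).node i) = some (edge r d).root := if_neg hi
    rw [(edge r d).dots_of_parent hp, dots_root, zero_add]
    simp only [hd]

end

theorem toMFF_redRoot : redRoot.toMFF = ((0 : Fin 2 → ℕ), -sym1 - sym2) := by
  have hp (i : Fin 2) : redRoot.parent (redRoot.node i) = some redRoot.root := rfl
  have hr : redRoot.red redRoot.root := rfl
  have hw (i : Fin 2) : ¬ redRoot.red (redRoot.node i) := redRoot.not_red_node i
  have hd (i : Fin 2) : ¬ redRoot.dotted (redRoot.node i) := id
  refine Prod.ext (funext fun i => ?_) ?_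
  · refine (redRoot.dots_of_parent (hp i)).trans ?_
    rw [dots_root, if_neg (hd i)]
    rfl
  · change redRoot.fraction = -sym1 - sym2
    have h1 : redRoot.factors = redRoot.factor redRoot.root +
        (redRoot.factor (redRoot.node 0) + redRoot.factor (redRoot.node 1)) := by
      rw [redRoot.factors_eq_sum (Equiv.refl (Option (Fin 2))), Fintype.sum_option,
        Fin.sum_univ_two]
      rfl
    have h2 (i : Fin 2) : redRoot.symbol (redRoot.node i) = ⟨{i}, Set.singleton_nonempty i⟩ := by
      refine Subtype.ext ((redRoot.desc_of_isLeaf ?_).trans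
        (Set.ext fun j => (Option.some_injective _).eq_iff))
      rintro (_ | c) hc <;> cases hc
    rw [fraction, h1, factor_of_red _ hr, if_pos hr, factor_of_not_red _ (hw 0),
      factor_of_not_red _ (hw 1), h2, h2, symbol_root, sym1, sym2]
    abel

theorem exists_toMFF_eq_of_mem_ff6Generators {A : mffOperad.obj (Fin 2)}
    (hA : A ∈ ff6Generators) : ∃ T : DottedTree (Fin 2), T.toMFF = A := by
  classical
  have h0 (r : Fin 2) : (edge r False).monomial = 0 :=
    funext fun i => (monomial_edge r False i).trans (if_neg fun h => h.1)
  rcases hA with rfl | rfl | rfl | rfl | rfl | rfl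
  -- In `1/([1][12])` the label `1` is on the leaf, so the root carries the label `2`, which is the
  -- element `1` of `Fin 2`.
  · exact ⟨edge 1 False, Prod.ext (h0 1) (fraction_edge 1 0 False (by decide))⟩
  · exact ⟨edge 0 False, Prod.ext (h0 0) (fraction_edge 0 1 False (by decide))⟩
  · exact ⟨twoLabels, toMFF_twoLabels⟩
  · exact ⟨redRoot, toMFF_redRoot⟩
  · refine ⟨edge 1 True, Prod.ext (funext fun i => ?_)
      (fraction_edge 1 0 True (by decide))⟩
    refine (monomial_edge 1 True i).trans ?_
    fin_cases i <;> simp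
  · refine ⟨edge 0 True, Prod.ext (funext fun i => ?_)
      (fraction_edge 0 1 True (by decide))⟩
    refine (monomial_edge 0 True i).trans ?_
    fin_cases i <;> simp

theorem exists_toMFF_eq_of_generated {I : Type} [Finite I] [Nonempty I] {A : mffOperad.obj I}
    (hA : mffOperad.Generated ff6Generators I A) : ∃ T : DottedTree I, T.toMFF = A := by
  induction hA with
  | one => exact ⟨single, toMFF_single⟩
  | gen A hA => exact exists_toMFF_eq_of_mem_ff6Generators hA
  | map f A _ ih =>
    obtain ⟨T, rfl⟩ := ih
    exact ⟨relabel f T, toMFF_relabel f T⟩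
  | comp x A B _ _ ihA ihB =>
    obtain ⟨T, rfl⟩ := ihA
    obtain ⟨T', rfl⟩ := ihB
    exact ⟨comp x T T', toMFF_comp x T T'⟩

/-! ### The isomorphism. -/

/-- The map from dotted red and white trees to `FF₆^Σ`. -/
noncomputable def toFF6 (I : Type) [Finite I] [Nonempty I] (T : dottedTreeOperad.obj I) :
    ff6Operad.obj I :=
  Quotient.lift (s := DottedTree.setoid I)
    (fun T => (⟨T.toMFF, T.generated_toMFF⟩ : ff6Operad.obj I))
    (fun _ _ ⟨f⟩ => Subtype.ext f.toMFF_eq) T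

theorem toFF6_bijective (I : Type) [Finite I] [Nonempty I] : Function.Bijective (toFF6 I) := by
  constructor
  · rintro ⟨T⟩ ⟨T'⟩ h
    exact Quotient.sound (equiv_of_toMFF_eq (congrArg Subtype.val h))
  · rintro ⟨A, hA⟩
    obtain ⟨T, rfl⟩ := exists_toMFF_eq_of_generated hA
    exact ⟨Quotient.mk _ T, rfl⟩

theorem toFF6_map {I J : Type} [Finite I] [Nonempty I] [Finite J] [Nonempty J] (f : I ≃ J)
    (T : dottedTreeOperad.obj I) :
    toFF6 J (dottedTreeOperad.map f T) = ff6Operad.map f (toFF6 I T) := by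
  obtain ⟨T⟩ := T
  exact Subtype.ext (toMFF_relabel f T)

theorem toFF6_one : toFF6 Unit dottedTreeOperad.one = ff6Operad.one := Subtype.ext toMFF_single

theorem toFF6_comp {I J : Type} [Finite I] [Nonempty I] [Finite J] [Nonempty J] (x : I)
    (T : dottedTreeOperad.obj I) (T' : dottedTreeOperad.obj J) :
    toFF6 (Ins x J) (dottedTreeOperad.comp x T T') =
      ff6Operad.comp x (toFF6 I T) (toFF6 J T') := by
  obtain ⟨T⟩ := T
  obtain ⟨T'⟩ := T'
  exact Subtype.ext (toMFF_comp x T T')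

end DottedTree

/-- The isomorphism from `FF₆^Σ` to dotted red and white trees. -/
noncomputable def ff6IsoDottedTree : ff6Operad.Iso dottedTreeOperad where
  equiv I _ _ := (Equiv.ofBijective _ (DottedTree.toFF6_bijective I)).symm
  map_comm {I J} _ _ _ _ f A := by
    rw [Equiv.symm_apply_eq, Equiv.ofBijective_apply, DottedTree.toFF6_map]
    congr 1
    exact ((Equiv.ofBijective _ (DottedTree.toFF6_bijective I)).apply_symm_apply A).symm
  one_comm := by
    rw [Equiv.symm_apply_eq, Equiv.ofBijective_apply, DottedTree.toFF6_one]
  comp_comm {I J} _ _ _ _ x A B := by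
    rw [Equiv.symm_apply_eq, Equiv.ofBijective_apply, DottedTree.toFF6_comp]
    congr 1
    · exact ((Equiv.ofBijective _ (DottedTree.toFF6_bijective I)).apply_symm_apply A).symm
    · exact ((Equiv.ofBijective _ (DottedTree.toFF6_bijective J)).apply_symm_apply B).symm

theorem ff6Operad_isSymmetricOperad : ff6Operad.IsSymmetricOperad :=
  mffOperad_isSymmetricOperad.generate ff6Generators

/-- Injectivity of the morphism to `FF₆^Σ` replaces a case analysis of iterated compositions over
the four rules. -/
theorem dottedTreeOperad_isSymmetricOperad : dottedTreeOperad.IsSymmetricOperad :=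
  ff6Operad_isSymmetricOperad.of_injective (fun I _ _ => DottedTree.toFF6 I)
    (fun I _ _ => (DottedTree.toFF6_bijective I).1) (fun f A => DottedTree.toFF6_map f A)
    DottedTree.toFF6_one (fun x A B => DottedTree.toFF6_comp x A B)

theorem mainTheorem11 :
    ff6Operad.IsSymmetricOperad ∧ dottedTreeOperad.IsSymmetricOperad ∧
      Nonempty (ff6Operad.Iso dottedTreeOperad) :=
  ⟨ff6Operad_isSymmetricOperad, dottedTreeOperad_isSymmetricOperad, ⟨ff6IsoDottedTree⟩⟩
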